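/- Notation. Sums over $p^m$ run over all pairs of a prime $p$ and an integer $m\ge 1$. Let $$\pi^*(x)=\tfrac12\sum_{p^m<x}\frac1m+\tfrac12\sum_{p^m\le x}\frac1m$$ be the normalized Riemann prime-counting function. For $c,\varepsilon>0$ let $$\eta_c(y)=\chi^*_{[-1,1]}(y)\,\frac{c}{2\sinh c}\,I_0\bigl(c\sqrt{1-y^2}\bigr),\qquad I_0(y)=\sum_{n\ge 0}\frac{(y/2)^{2n}}{(n!)^2},$$ where $\chi^*_A$ equals $1$ in the interior of $A$, $\tfrac12$ on its boundary and $0$ outside its closure, and put $\eta_{c,\varepsilon}(y)=\frac1\varepsilon\eta_c(y/\varepsilon)$ and $$\ell_{c,\varepsilon}(\xi)=\int_{-\infty}^{\infty}\eta_{c,\varepsilon}(t)e^{i\xi t}\,dt\quad(\xi\in\mathbb C)$$ (a dilated Logan function). Let $\lambda_{c,\varepsilon}=\ell_{c,\varepsilon}(i/2)$, $A_{c,\varepsilon}=-\ell_{c,\varepsilon}''(0)/2$, $f_k(t)=e^{t/2}/t^k$, and for $|t|>\varepsilon$ $$\phi_{x,c,\varepsilon}(t)=\lambda_{c,\varepsilon}^{-1}\Bigl[\bigl(\chi_{(-\infty,\log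 x]}\,(f_1+A_{c,\varepsilon}(f_2-2f_3))\bigr)*\eta_{c,\varepsilon}\Bigr](t),$$ where $\chi_{(-\infty,\log x]}$ is the ordinary characteristic function and $(f*g)(t)=\int_{-\infty}^\infty f(y)g(t-y)\,dy$. For $0<\varepsilon<\log 2$ the modified prime-counting function is $$\pi^*_{c,\varepsilon}(x)=\sum_{p^m}\frac{\log p}{p^{m/2}}\,\phi_{x,c,\varepsilon}(m\log p).$$ Let $\mu_{c,\varepsilon}$ be the odd function with $\mu_{c,\varepsilon}(t)=-\int_{-\infty}^t\eta_{c,\varepsilon}(\tau)\,d\tau$ for $t<0$ and $\mu_{c,\varepsilon}(0)=0$, let $\nu_{c,\varepsilon}(t)=\int_{-\infty}^t\mu_{c,\varepsilon}(\tau)\,d\tau$, and let $$M_{x,c,\varepsilon}(t)=\lambda_{c,\varepsilon}^{-1}\Bigl[\mu_{c,\varepsilon}\bigl(\log\tfrac tx\bigr)+\Bigl(\frac1{\log t}-\frac12\Bigr)\Bigl(\mu_{c,\varepsilon}\bigl(\log\tfrac tx\bigr)\log\tfrac tx-\nu_{c,\varepsilon}\bigl(\log\tfrac tx\bigr)\Bigr)\Bigr].$$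 Theorem. Let $x>e^{10}$, $c\ge 1$ and $x^{-1}<\varepsilon\le 10^{-3}$. Then the sum defining $\pi^*_{c,\varepsilon}(x)$ converges absolutely, and $$\pi^*_{c,\varepsilon}(x)=\pi^*(x)+\sum_{e^{-\varepsilon}x<p^m<e^{\varepsilon}x}\frac1m M_{x,c,\varepsilon}(p^m)+R(x,c,\varepsilon),$$ where $$|R(x,c,\varepsilon)|\le\frac{0.57\,\varepsilon^3x}{c\log(\varepsilon x)}+\frac{39\,\varepsilon^4x}{c^3}+\frac{0.13\,\varepsilon^2\log\log(2x^2)}{c}.$$ -/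

import Mathlib

open MeasureTheory

noncomputable section

namespace LoganPi

/-- Index set for sums over prime powers `p ^ m`: pairs of a prime `p` and an exponent `m ≥ 1`. -/
abbrev PP : Type := Nat.Primes × ℕ+

/-- The prime `p` of the pair, as a real number. -/
def PP.p (q : PP) : ℝ := ((q.1 : ℕ) : ℝ)

/-- The exponent `m` of the pair, as a natural number. -/
def PP.m (q : PP) : ℕ := (q.2 : ℕ)

/-- The prime power `p ^ m`, as a real number. -/
def PP.val (q : PP) : ℝ := q.p ^ q.m

/-- There are finitely many prime powers up to `y`, so the sums below with a condition that bounds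
`p ^ m` from above are finite sums. -/
theorem finite_setOf_val_le (y : ℝ) : {q : PP | q.val ≤ y}.Finite := by
  have hinj : Function.Injective (fun q : PP => ((q.1 : ℕ), (q.2 : ℕ))) := by
    rintro ⟨p, m⟩ ⟨p', m'⟩ h
    simp only [Prod.mk.injEq] at h
    exact Prod.ext (Subtype.ext h.1) (PNat.coe_injective h.2)
  refine Set.Finite.subset (((Set.finite_Iic ⌊y⌋₊).prod (Set.finite_Iic ⌊y⌋₊)).preimage
    hinj.injOn) ?_
  rintro ⟨p, m⟩ hq
  have hq' : (((p : ℕ) ^ (m : ℕ) : ℕ) : ℝ) ≤ y := by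
    simpa [PP.val, PP.p, PP.m] using hq
  have hle : (p : ℕ) ^ (m : ℕ) ≤ ⌊y⌋₊ := Nat.le_floor hq'
  have h1 : (p : ℕ) ≤ (p : ℕ) ^ (m : ℕ) := Nat.le_self_pow m.pos.ne' _
  have h2 : (m : ℕ) ≤ (p : ℕ) ^ (m : ℕ) := (Nat.lt_pow_self p.2.one_lt).le
  exact ⟨h1.trans hle, h2.trans hle⟩

open Classical in
/-- The normalized Riemann prime-counting function
`π*(x) = ½ ∑_{p^m < x} 1/m + ½ ∑_{p^m ≤ x} 1/m`. -/
def piStar (x : ℝ) : ℝ :=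
  (1 / 2) * (∑' q : PP, if q.val < x then 1 / (q.m : ℝ) else 0) +
    (1 / 2) * (∑' q : PP, if q.val ≤ x then 1 / (q.m : ℝ) else 0)

/-- The normalized characteristic function of a set of reals: `1` in the interior, `1/2` on the
boundary, `0` outside the closure. -/
def chiStar (A : Set ℝ) (t : ℝ) : ℝ :=
  (interior A).indicator (fun _ => 1) t + (frontier A).indicator (fun _ => 1 / 2) t

/-- The modified Bessel function of the first kind `I₀`. -/
def besselI0 (y : ℝ) : ℝ := ∑' n : ℕ, (y / 2) ^ (2 * n) / ((n.factorial : ℝ) ^ 2)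

/-- The kernel `η_c`, the inverse Fourier transform of the Logan function. -/
def eta1 (c y : ℝ) : ℝ :=
  chiStar (Set.Icc (-1) 1) y * (c / (2 * Real.sinh c)) * besselI0 (c * √(1 - y ^ 2))

/-- The dilated kernel `η_{c,ε}`. -/
def eta (c ε y : ℝ) : ℝ := 1 / ε * eta1 c (y / ε)

/-- The Fourier transform `ĝ(ξ) = ∫ g(t) e^{iξt} dt` at a complex argument. -/
def fourierHat (g : ℝ → ℝ) (ξ : ℂ) : ℂ :=
  ∫ t : ℝ, (g t : ℂ) * Complex.exp (Complex.I * ξ * (t : ℂ))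

/-- The dilated Logan function `ℓ_{c,ε}`, the Fourier transform of `η_{c,ε}`. -/
def ell (c ε : ℝ) (ξ : ℂ) : ℂ := fourierHat (eta c ε) ξ

/-- `λ_{c,ε} = ℓ_{c,ε}(i/2)`, which is a real number since `η_{c,ε}` is real-valued. -/
def lam (c ε : ℝ) : ℝ := (ell c ε (Complex.I / 2)).re

/-- `A_{c,ε} = -ℓ''_{c,ε}(0)/2`, which is a real number since `η_{c,ε}` is real-valued. -/
def coeffA (c ε : ℝ) : ℝ := (-(iteratedDeriv 2 (ell c ε) 0) / 2).re

/-- `f_k(t) = e^{t/2} / t^k`. -/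
def f (k : ℕ) (t : ℝ) : ℝ := Real.exp (t / 2) / t ^ k

/-- The weight function `φ_{x,c,ε}`. It is used only at `t > ε`, where the kernel keeps the
convolution away from the singularity of `f_k` at `0`. -/
def phi (x c ε t : ℝ) : ℝ :=
  (lam c ε)⁻¹ *
    convolution
      ((Set.Iic (Real.log x)).indicator
        (fun s => f 1 s + coeffA c ε * (f 2 s - 2 * f 3 s)))
      (eta c ε) (ContinuousLinearMap.mul ℝ ℝ) volume t

/-- The summand `(log p / p^{m/2}) φ_{x,c,ε}(m log p)`. -/
def piModTerm (x c ε : ℝ) (q : PP) : ℝ :=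
  Real.log q.p / q.p ^ ((q.m : ℝ) / 2) * phi x c ε ((q.m : ℝ) * Real.log q.p)

/-- The modified prime-counting function `π*_{c,ε}(x)`. -/
def piMod (c ε x : ℝ) : ℝ := ∑' q : PP, piModTerm x c ε q

/-- The odd function `μ_{c,ε}` with `μ_{c,ε}(t) = -∫_{-∞}^t η_{c,ε}` for `t < 0`. -/
def mu (c ε t : ℝ) : ℝ :=
  if t < 0 then -∫ τ in Set.Iic t, eta c ε τ
  else if 0 < t then ∫ τ in Set.Iic (-t), eta c ε τ
  else 0

/-- `ν_{c,ε}(t) = ∫_{-∞}^t μ_{c,ε}`. -/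
def nu (c ε t : ℝ) : ℝ := ∫ τ in Set.Iic t, mu c ε τ

/-- The function `M_{x,c,ε}`. -/
def bigM (x c ε t : ℝ) : ℝ :=
  (lam c ε)⁻¹ *
    (mu c ε (Real.log (t / x)) +
      (1 / Real.log t - 1 / 2) *
        (mu c ε (Real.log (t / x)) * Real.log (t / x) - nu c ε (Real.log (t / x))))

open Classical in
/-- The sum of `(1/m) M_{x,c,ε}(p^m)` over the prime powers with `e^{-ε} x < p^m < e^ε x`. -/
def shortSum (x c ε : ℝ) : ℝ :=
  ∑' q : PP, if Real.exp (-ε) * x < q.val ∧ q.val < Real.exp ε * x then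
    1 / (q.m : ℝ) * bigM x c ε q.val else 0

end LoganPi

end

/-!
Multiplied by `λ t e^{-t/2}`, the weight `φ` at `t = m log p` becomes the integral over
`[t - log x, ∞)` of a smooth kernel against `η`; expand that kernel at `y = 0`. If
`|t - log x| > ε`, the integral is either `0` or over the whole support of `η`, and the weight
equals its ideal value `0` or `1 / m` up to `O(ε² A / m)`, because the mean of `A (f₂ - 2 f₃)`
cancels the second-order term of `f₁` and the odd terms vanish. If `|t - log x| ≤ ε`, the terms of
order zero and one are exactly the ideal weight plus `M / m`, the antiderivatives `μ` and `ν` being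
the truncated moments of `η`, and those of second order cancel up to about `A / (8 m)`. The power
series of `I₀` gives `A ≤ ε² / (2 c)`. It remains to bound the sum of `1 / m` over the prime powers
in `(e^{-ε} x, e^ε x)`, which a Brun–Titchmarsh inequality from Selberg's sieve does for the primes.
-/

namespace SelbergUpperBound

open Finset ArithmeticFunction BoundingSieve UniqueFactorizationMonoid
open scoped ArithmeticFunction.Moebius

section General

variable (s : BoundingSieve) (Z : ℕ)

/-- The divisors of the sifting product that do not exceed the level `Z`: the support of Selberg's
weights. -/
def sieveSupport : Finset ℕ := {k ∈ s.prodPrimes.divisors | k ≤ Z}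

/-- The denominator `∑_{k ∣ P, k ≤ Z} g(k)` of the main term of Selberg's bound. -/
noncomputable def selbergMass : ℝ := ∑ k ∈ sieveSupport s Z, s.selbergTerms k

/-- Selberg's weights `λ_d`: the minimizer, under `λ_1 = 1`, of the quadratic form which is the
main term of the `Λ²` sieve of level `Z`. -/
noncomputable def selbergWeight (d : ℕ) : ℝ :=
  μ d * ((s.nu d)⁻¹ * ∑ k ∈ sieveSupport s Z with d ∣ k, s.selbergTerms k) / selbergMass s Z

variable {s Z}

theorem mem_sieveSupport {d : ℕ} : d ∈ sieveSupport s Z ↔ d ∣ s.prodPrimes ∧ d ≤ Z := by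
  simp [sieveSupport, prodPrimes_ne_zero]

theorem mem_sieveSupport_of_dvd {d k : ℕ} (hk : k ∈ sieveSupport s Z) (h : d ∣ k) :
    d ∈ sieveSupport s Z := by
  rw [mem_sieveSupport] at hk ⊢
  have hk0 : k ≠ 0 := ne_zero_of_dvd_ne_zero prodPrimes_ne_zero hk.1
  exact ⟨h.trans hk.1, (Nat.le_of_dvd (Nat.pos_of_ne_zero hk0) h).trans hk.2⟩

theorem one_mem_sieveSupport (hZ : 1 ≤ Z) : 1 ∈ sieveSupport s Z :=
  mem_sieveSupport.2 ⟨one_dvd _, hZ⟩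

theorem selbergTerms_nonneg_of_mem {k : ℕ} (hk : k ∈ sieveSupport s Z) : 0 ≤ s.selbergTerms k :=
  (selbergTerms_pos (mem_sieveSupport.1 hk).1).le

theorem selbergMass_pos (hZ : 1 ≤ Z) : 0 < selbergMass s Z :=
  sum_pos (fun _ hk => selbergTerms_pos (mem_sieveSupport.1 hk).1) ⟨1, one_mem_sieveSupport hZ⟩

theorem selbergWeight_one (hZ : 1 ≤ Z) : selbergWeight s Z 1 = 1 := by
  have hmass : selbergMass s Z ≠ 0 := (selbergMass_pos hZ).ne'
  rw [selbergMass] at hmass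
  simp [selbergWeight, selbergMass, s.nu_mult.map_one, hmass]

theorem selbergWeight_eq_zero {d : ℕ} (hd : d ∉ sieveSupport s Z) : selbergWeight s Z d = 0 := by
  rw [selbergWeight, filter_eq_empty_iff.2 fun k hk hdk => hd (mem_sieveSupport_of_dvd hk hdk)]
  simp

theorem coprime_div_of_mem_sieveSupport {d k : ℕ} (hk : k ∈ sieveSupport s Z) (hdk : d ∣ k) :
    d.Coprime (k / d) :=
  Nat.coprime_of_squarefree_mul <| by
    rw [Nat.mul_div_cancel' hdk]
    exact s.prodPrimes_squarefree.squarefree_of_dvd (mem_sieveSupport.1 hk).1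

theorem sum_divisors_selbergTerms {d : ℕ} (hd : d ∣ s.prodPrimes) :
    ∑ l ∈ d.divisors, s.selbergTerms l = s.selbergTerms d * (s.nu d)⁻¹ := by
  rw [← sum_divisors_selbergTerms_eq_selbergTerms_mul_nu_inv hd, ← sum_filter,
    Nat.divisors_filter_dvd_of_dvd prodPrimes_ne_zero hd]

theorem injOn_mul_div_sieveSupport (d : ℕ) :
    Set.InjOn (fun q : ℕ × ℕ => q.2 * (q.1 / d))
      ({k ∈ sieveSupport s Z | d ∣ k} ×ˢ d.divisors : Finset (ℕ × ℕ)) := by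
  have hgcd : ∀ k ∈ sieveSupport s Z, d ∣ k → ∀ l, l ∣ d → Nat.gcd (l * (k / d)) d = l := by
    intro k hk hdk l hl
    rw [Nat.Coprime.gcd_mul_right_cancel _ (coprime_div_of_mem_sieveSupport hk hdk).symm,
      Nat.gcd_eq_left hl]
  rintro ⟨k, l⟩ h ⟨k', l'⟩ h' heq
  simp only [coe_product, coe_filter, Set.mem_prod, Set.mem_ofPred_eq, mem_coe] at h h' heq
  obtain ⟨⟨hk, hdk⟩, hl⟩ := h
  obtain ⟨⟨hk', hdk'⟩, hl'⟩ := h'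
  obtain rfl : l = l' := by
    rw [← hgcd k hk hdk l (Nat.dvd_of_mem_divisors hl),
      ← hgcd k' hk' hdk' l' (Nat.dvd_of_mem_divisors hl'), heq]
  have hdiv : k / d = k' / d := Nat.eq_of_mul_eq_mul_left (Nat.pos_of_mem_divisors hl) heq
  rw [← Nat.mul_div_cancel' hdk, hdiv, Nat.mul_div_cancel' hdk']

/-- Multiplicativity writes the left side as a sum of `g(l · k / d)` over `l ∣ d`; these arguments
are distinct elements of the support. -/
theorem nu_inv_mul_sum_selbergTerms_le {d : ℕ} (hd : d ∣ s.prodPrimes) :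
    (s.nu d)⁻¹ * ∑ k ∈ sieveSupport s Z with d ∣ k, s.selbergTerms k ≤ selbergMass s Z := by
  have hexpand : (s.nu d)⁻¹ * ∑ k ∈ sieveSupport s Z with d ∣ k, s.selbergTerms k =
      ∑ q ∈ {k ∈ sieveSupport s Z | d ∣ k} ×ˢ d.divisors, s.selbergTerms (q.2 * (q.1 / d)) := by
    rw [sum_product, mul_sum]
    refine sum_congr rfl fun k hk => ?_
    obtain ⟨hk, hdk⟩ := mem_filter.1 hk
    have hcop := coprime_div_of_mem_sieveSupport hk hdk
    calc (s.nu d)⁻¹ * s.selbergTerms k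
        = (s.selbergTerms d * (s.nu d)⁻¹) * s.selbergTerms (k / d) := by
          conv_lhs => rw [← Nat.mul_div_cancel' hdk,
            selbergTerms_isMultiplicative.map_mul_of_coprime hcop]
          ring
      _ = ∑ l ∈ d.divisors, s.selbergTerms (l * (k / d)) := by
          rw [← sum_divisors_selbergTerms hd, sum_mul]
          exact sum_congr rfl fun l hl => (selbergTerms_isMultiplicative.map_mul_of_coprime
            (hcop.coprime_dvd_left (Nat.dvd_of_mem_divisors hl))).symm
  rw [hexpand, ← sum_image (f := s.selbergTerms) (injOn_mul_div_sieveSupport d), selbergMass]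
  refine sum_le_sum_of_subset_of_nonneg (fun n hn => ?_) fun k hk _ =>
    selbergTerms_nonneg_of_mem hk
  obtain ⟨⟨k, l⟩, h, rfl⟩ := mem_image.1 hn
  obtain ⟨hk, hl⟩ := mem_product.1 h
  obtain ⟨hk, hdk⟩ := mem_filter.1 hk
  refine mem_sieveSupport_of_dvd hk ?_
  calc l * (k / d) ∣ d * (k / d) := Nat.mul_dvd_mul_right (Nat.dvd_of_mem_divisors hl) _
    _ = k := Nat.mul_div_cancel' hdk

theorem abs_selbergWeight_le_one {d : ℕ} (hd : d ∣ s.prodPrimes) : |selbergWeight s Z d| ≤ 1 := by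
  have hmass : 0 ≤ selbergMass s Z := sum_nonneg fun _ => selbergTerms_nonneg_of_mem
  have hmoebius : |((μ d : ℤ) : ℝ)| ≤ 1 := by exact_mod_cast abs_moebius_le_one
  have hsum : 0 ≤ (s.nu d)⁻¹ * ∑ k ∈ sieveSupport s Z with d ∣ k, s.selbergTerms k :=
    mul_nonneg (inv_nonneg.2 (nu_pos_of_dvd_prodPrimes hd).le) <|
      sum_nonneg fun k hk => selbergTerms_nonneg_of_mem (mem_filter.1 hk).1
  rw [selbergWeight, mul_div_assoc, abs_mul, abs_of_nonneg (div_nonneg hsum hmass)]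
  exact mul_le_one₀ hmoebius (div_nonneg hsum hmass)
    (div_le_one_of_le₀ (nu_inv_mul_sum_selbergTerms_le hd) hmass)

theorem sum_divisors_moebius (m : ℕ) :
    ∑ e ∈ m.divisors, ((μ e : ℤ) : ℝ) = if m = 1 then 1 else 0 := by
  have h := congrArg (fun g : ArithmeticFunction ℝ => g m) coe_moebius_mul_coe_zeta
  simpa only [coe_mul_zeta_apply, one_apply, intCoe_apply] using h

theorem sum_moebius_divisors_filter_dvd {k j : ℕ} (hj : Squarefree j) :
    ∑ d ∈ j.divisors with k ∣ d, ((μ d : ℤ) : ℝ) = if j = k then (μ k : ℝ) else 0 := by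
  by_cases hkj : k ∣ j
  · obtain ⟨m, rfl⟩ := hkj
    obtain ⟨hcop, -, -⟩ := Nat.squarefree_mul_iff.1 hj
    have hk0 : k ≠ 0 := left_ne_zero_of_mul hj.ne_zero
    have himage : {d ∈ (k * m).divisors | k ∣ d} = m.divisors.image (k * ·) := by
      ext d
      simp only [mem_filter, Nat.mem_divisors, mem_image]
      constructor
      · rintro ⟨⟨hd, -⟩, e, rfl⟩
        exact ⟨e, ⟨Nat.dvd_of_mul_dvd_mul_left (Nat.pos_of_ne_zero hk0) hd,
          right_ne_zero_of_mul hj.ne_zero⟩, rfl⟩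
      · rintro ⟨e, ⟨he, -⟩, rfl⟩
        exact ⟨⟨Nat.mul_dvd_mul_left k he, hj.ne_zero⟩, dvd_mul_right _ _⟩
    have hmul : ∀ e ∈ m.divisors, ((μ (k * e) : ℤ) : ℝ) = μ k * (μ e : ℝ) := fun e he => by
      rw [isMultiplicative_moebius.map_mul_of_coprime
        (hcop.coprime_dvd_right (Nat.dvd_of_mem_divisors he)), Int.cast_mul]
    rw [himage, sum_image fun a _ b _ h => mul_left_cancel₀ hk0 h, sum_congr rfl hmul,
      ← mul_sum, sum_divisors_moebius, mul_ite, mul_one, mul_zero]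
    simp [hk0]
  · rw [filter_eq_empty_iff.2 fun d hd hkd => hkj (hkd.trans (Nat.dvd_of_mem_divisors hd)),
      sum_empty, if_neg (by rintro rfl; exact hkj dvd_rfl)]

theorem sum_nu_mul_selbergWeight {l : ℕ} :
    (∑ d ∈ s.prodPrimes.divisors, if l ∣ d then s.nu d * selbergWeight s Z d else 0) =
      if l ∈ sieveSupport s Z then μ l * s.selbergTerms l / selbergMass s Z else 0 := by
  have hterm : ∀ d ∈ s.prodPrimes.divisors, s.nu d * selbergWeight s Z d =
      ∑ j ∈ sieveSupport s Z, if d ∣ j then s.selbergTerms j / selbergMass s Z * μ d else 0 := by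
    intro d hd
    have hnu : s.nu d ≠ 0 := nu_ne_zero (Nat.dvd_of_mem_divisors hd)
    rw [selbergWeight, ← sum_filter, ← sum_mul, ← sum_div]
    field_simp
  have hinner : ∀ j ∈ sieveSupport s Z,
      (∑ d ∈ s.prodPrimes.divisors with l ∣ d,
        if d ∣ j then s.selbergTerms j / selbergMass s Z * (μ d : ℝ) else 0) =
      if j = l then μ l * s.selbergTerms l / selbergMass s Z else 0 := by
    intro j hj
    have hjP := (mem_sieveSupport.1 hj).1
    rw [← sum_filter, filter_comm, Nat.divisors_filter_dvd_of_dvd prodPrimes_ne_zero hjP, ← mul_sum,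
      sum_moebius_divisors_filter_dvd (s.prodPrimes_squarefree.squarefree_of_dvd hjP)]
    split_ifs with h
    · subst h; ring
    · simp
  rw [← sum_filter, sum_congr rfl fun d hd => hterm d (mem_filter.1 hd).1, sum_comm,
    sum_congr rfl hinner, sum_ite_eq']

theorem mainSum_lambdaSquared_selbergWeight (hZ : 1 ≤ Z) :
    s.mainSum (lambdaSquared (selbergWeight s Z)) = (selbergMass s Z)⁻¹ := by
  have hmass := (selbergMass_pos (s := s) hZ).ne'
  have hterm : ∀ l ∈ sieveSupport s Z,
      (s.selbergTerms l)⁻¹ * (μ l * s.selbergTerms l / selbergMass s Z) ^ 2 =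
        s.selbergTerms l * ((selbergMass s Z)⁻¹) ^ 2 := by
    intro l hl
    have hlP := (mem_sieveSupport.1 hl).1
    have hmoebius : ((μ l : ℤ) : ℝ) ^ 2 = 1 := by
      exact_mod_cast moebius_sq_eq_one_of_squarefree
        (s.prodPrimes_squarefree.squarefree_of_dvd hlP)
    have hg := (selbergTerms_pos hlP).ne'
    rw [div_pow, mul_pow, hmoebius]
    field_simp
  rw [mainSum_lambdaSquared_eq_sum_mul_sum_sq]
  simp only [sum_nu_mul_selbergWeight, ite_pow, mul_ite, ne_eq, OfNat.ofNat_ne_zero,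
    not_false_eq_true, zero_pow, mul_zero]
  have hsubset : sieveSupport s Z ⊆ s.prodPrimes.divisors := filter_subset _ _
  rw [← sum_filter, filter_mem_eq_inter, inter_eq_right.2 hsubset,
    sum_congr rfl hterm, ← sum_mul, ← selbergMass]
  field_simp

theorem lambdaSquared_selbergWeight {n : ℕ} (hn : n ∈ s.prodPrimes.divisors) :
    lambdaSquared (selbergWeight s Z) n = ∑ d ∈ sieveSupport s Z, ∑ e ∈ sieveSupport s Z,
      if n = d.lcm e then selbergWeight s Z d * selbergWeight s Z e else 0 := by
  have hn0 := (Nat.pos_of_mem_divisors hn).ne'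
  rw [lambdaSquared, ← sum_product', ← sum_product']
  refine sum_congr_of_eq_on_inter (fun q _ hq => ?_) (fun q _ hq => ?_) fun _ _ _ => rfl
  · rw [mem_product, not_and_or] at hq
    rcases hq with hq | hq <;> simp [selbergWeight_eq_zero hq]
  · refine if_neg fun hlcm => hq ?_
    simp only [mem_product, Nat.mem_divisors]
    exact ⟨⟨hlcm ▸ Nat.dvd_lcm_left .., hn0⟩, hlcm ▸ Nat.dvd_lcm_right .., hn0⟩

theorem errSum_lambdaSquared_selbergWeight_le :
    s.errSum (lambdaSquared (selbergWeight s Z)) ≤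
      ∑ d ∈ sieveSupport s Z, ∑ e ∈ sieveSupport s Z, |s.rem (d.lcm e)| := by
  have hlambda : ∀ n ∈ s.prodPrimes.divisors, |lambdaSquared (selbergWeight s Z) n| ≤
      ∑ d ∈ sieveSupport s Z, ∑ e ∈ sieveSupport s Z, if n = d.lcm e then 1 else 0 := by
    intro n hn
    rw [lambdaSquared_selbergWeight hn]
    refine (abs_sum_le_sum_abs _ _).trans <| sum_le_sum fun d hd =>
      (abs_sum_le_sum_abs _ _).trans <| sum_le_sum fun e he => ?_
    split_ifs
    · rw [abs_mul]
      exact mul_le_one₀ (abs_selbergWeight_le_one (mem_sieveSupport.1 hd).1) (abs_nonneg _)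
        (abs_selbergWeight_le_one (mem_sieveSupport.1 he).1)
    · rw [abs_zero]
  calc s.errSum (lambdaSquared (selbergWeight s Z))
      ≤ ∑ n ∈ s.prodPrimes.divisors, ∑ d ∈ sieveSupport s Z, ∑ e ∈ sieveSupport s Z,
          if n = d.lcm e then |s.rem n| else 0 := by
        refine sum_le_sum fun n hn => ?_
        refine (mul_le_mul_of_nonneg_right (hlambda n hn) (abs_nonneg _)).trans_eq ?_
        simp only [sum_mul, ite_mul, one_mul, zero_mul]
    _ = ∑ d ∈ sieveSupport s Z, ∑ e ∈ sieveSupport s Z, |s.rem (d.lcm e)| := by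
        rw [sum_comm]
        refine sum_congr rfl fun d hd => ?_
        rw [sum_comm]
        refine sum_congr rfl fun e he => ?_
        rw [sum_ite_eq', if_pos]
        exact Nat.mem_divisors.2 ⟨Nat.lcm_dvd (mem_sieveSupport.1 hd).1 (mem_sieveSupport.1 he).1,
          prodPrimes_ne_zero⟩

theorem siftedSum_le (hZ : 1 ≤ Z) :
    s.siftedSum ≤ s.totalMass / selbergMass s Z +
      ∑ d ∈ sieveSupport s Z, ∑ e ∈ sieveSupport s Z, |s.rem (d.lcm e)| := by
  refine (siftedSum_le_mainSum_errSum_of_upperMoebius (s := s) _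
    (upperMoebius_lambdaSquared _ (selbergWeight_one (s := s) hZ))).trans ?_
  rw [mainSum_lambdaSquared_selbergWeight hZ, ← div_eq_mul_inv]
  gcongr
  exact errSum_lambdaSquared_selbergWeight_le

end General

/-- Each `n` with radical `k` is `k` times an integer composed of primes dividing `k`, and the
reciprocals of the latter sum to the Euler product. -/
theorem sum_inv_le_of_radical_eq {k : ℕ} (S : Finset ℕ) (hS : ∀ n ∈ S, n ≠ 0 ∧ radical n = k) :
    ∑ n ∈ S, (n : ℝ)⁻¹ ≤ (k : ℝ)⁻¹ * ∏ p ∈ k.primeFactors, (1 - (p : ℝ)⁻¹)⁻¹ := by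
  let F : ℕ →* ℝ := (invMonoidHom (α := ℝ)).comp (Nat.castRingHom ℝ)
  have hF : ∀ {p : ℕ}, p.Prime → ‖F p‖ < 1 := fun {p} hp => by
    simpa [F] using inv_lt_one_of_one_lt₀ (Nat.one_lt_cast (α := ℝ).2 hp.one_lt)
  have heuler := (EulerProduct.summable_and_hasSum_factoredNumbers_prod_filter_prime_geometric
    hF k.primeFactors).2
  rw [filter_true_of_mem fun p hp => Nat.prime_of_mem_primeFactors hp] at heuler
  have hdvd : ∀ n ∈ S, k ∣ n := fun n hn => (hS n hn).2 ▸ radical_dvd_self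
  have hinj : Set.InjOn (· / k) (S : Set ℕ) := fun a ha b hb hab => by
    rw [← Nat.mul_div_cancel' (hdvd a ha), ← Nat.mul_div_cancel' (hdvd b hb)]
    exact congrArg (k * ·) hab
  have hfactored : ∀ n ∈ S, n / k ∈ Nat.factoredNumbers k.primeFactors := fun n hn => by
    obtain ⟨hn0, rfl⟩ := hS n hn
    rw [Nat.primeFactors_radical]
    exact Nat.mem_factoredNumbers_of_primeFactors_subset
      (Nat.div_ne_zero_iff_of_dvd radical_dvd_self |>.2 ⟨hn0, radical_ne_zero⟩)
      (Nat.primeFactors_mono (Nat.div_dvd_of_dvd radical_dvd_self) hn0)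
  have hle := sum_le_hasSum (S.image (· / k))
    (fun n _ => Set.indicator_nonneg (fun m _ => by simp [F]) n)
    (hasSum_subtype_iff_indicator.1 heuler)
  rw [sum_image hinj] at hle
  calc ∑ n ∈ S, (n : ℝ)⁻¹
      = (k : ℝ)⁻¹ * ∑ n ∈ S, (Nat.factoredNumbers k.primeFactors).indicator F (n / k) := by
        rw [mul_sum]
        refine sum_congr rfl fun n hn => ?_
        rw [Set.indicator_of_mem (hfactored n hn)]
        conv_lhs => rw [← Nat.mul_div_cancel' (hdvd n hn), Nat.cast_mul, mul_inv]
        rfl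
    _ ≤ (k : ℝ)⁻¹ * ∏ p ∈ k.primeFactors, (1 - (p : ℝ)⁻¹)⁻¹ := by
        gcongr
        exact hle

/-- The natural numbers in the open real interval `(a, b)`, which the sieve below acts on. For
`a < 0` the truncation in `⌊a⌋₊` would lose `0`. -/
noncomputable def natsIn (a b : ℝ) : Finset ℕ := Ioo ⌊a⌋₊ ⌈b⌉₊

theorem mem_natsIn {a b : ℝ} (ha : 0 ≤ a) {n : ℕ} : n ∈ natsIn a b ↔ a < n ∧ (n : ℝ) < b := by
  rw [natsIn, mem_Ioo, Nat.floor_lt ha, Nat.lt_ceil]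

theorem abs_card_natsIn_sub_le {a b : ℝ} (ha : 0 ≤ a) (hab : a < b) :
    |(#(natsIn a b) : ℝ) - (b - a)| ≤ 1 := by
  have hfloor : (⌊a⌋₊ : ℝ) ≤ a := Nat.floor_le ha
  have hceil : b ≤ ⌈b⌉₊ := Nat.le_ceil b
  have hfloor' : a < ⌊a⌋₊ + 1 := Nat.lt_floor_add_one a
  have hceil' : (⌈b⌉₊ : ℝ) < b + 1 := Nat.ceil_lt_add_one (ha.trans hab.le)
  have hlt : ⌊a⌋₊ < ⌈b⌉₊ := by exact_mod_cast hfloor.trans_lt (hab.trans_le hceil)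
  have hcard : (#(natsIn a b) : ℝ) = ⌈b⌉₊ - ⌊a⌋₊ - 1 := by
    rw [natsIn, Nat.card_Ioo, Nat.sub_sub, Nat.cast_sub hlt]
    push_cast
    ring
  rw [hcard, abs_le]
  constructor <;> linarith

theorem card_filter_dvd_natsIn {a b : ℝ} (ha : 0 ≤ a) {d : ℕ} (hd : 0 < d) :
    #{n ∈ natsIn a b | d ∣ n} = #(natsIn (a / d) (b / d)) := by
  have hd' : (0 : ℝ) < d := Nat.cast_pos.2 hd
  have himage : {n ∈ natsIn a b | d ∣ n} = (natsIn (a / d) (b / d)).image (d * ·) := by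
    ext n
    simp only [mem_filter, mem_image, mem_natsIn ha, mem_natsIn (div_nonneg ha hd'.le),
      div_lt_iff₀' hd', lt_div_iff₀' hd', ← Nat.cast_mul]
    constructor
    · rintro ⟨h, k, rfl⟩
      exact ⟨k, h, rfl⟩
    · rintro ⟨k, h, rfl⟩
      exact ⟨h, dvd_mul_right d k⟩
  rw [himage, card_image_of_injective _ fun _ _ => Nat.eq_of_mul_eq_mul_left hd]

/-- The sieve of `(a, b)` by the primes up to `Z`, with density `1 / d` of the multiples of `d`. -/
noncomputable def intervalSieve (a b : ℝ) (Z : ℕ) : BoundingSieve where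
  support := natsIn a b
  prodPrimes := primorial Z
  prodPrimes_squarefree := squarefree_primorial Z
  weights := 1
  weights_nonneg _ := zero_le_one
  totalMass := b - a
  nu := ⟨fun n => (n : ℝ)⁻¹, by simp⟩
  nu_mult := ⟨by simp, fun {m n} _ => by simp [mul_comm]⟩
  nu_pos_of_prime _ hp _ := inv_pos.2 (Nat.cast_pos.2 hp.pos)
  nu_lt_one_of_prime _ hp _ := inv_lt_one_of_one_lt₀ (Nat.one_lt_cast.2 hp.one_lt)

theorem intervalSieve_nu_apply (a b : ℝ) (Z n : ℕ) : (intervalSieve a b Z).nu n = (n : ℝ)⁻¹ := rfl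

theorem abs_rem_intervalSieve_le_one {a b : ℝ} (ha : 0 ≤ a) (hab : a < b) {Z d : ℕ} (hd : 0 < d) :
    |(intervalSieve a b Z).rem d| ≤ 1 := by
  have hd' : (0 : ℝ) < d := Nat.cast_pos.2 hd
  have hrem : (intervalSieve a b Z).rem d = (#(natsIn (a / d) (b / d)) : ℝ) - (b / d - a / d) := by
    rw [← card_filter_dvd_natsIn ha hd, rem, multSum, ← sum_filter, intervalSieve_nu_apply]
    simp only [intervalSieve, Pi.one_apply, sum_const, nsmul_eq_mul, mul_one]
    ring
  rw [hrem]
  exact abs_card_natsIn_sub_le (div_nonneg ha hd'.le) (by gcongr)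

theorem radical_mem_sieveSupport {a b : ℝ} {Z n : ℕ} (hn : n ∈ Icc 1 Z) :
    radical n ∈ sieveSupport (intervalSieve a b Z) Z := by
  obtain ⟨hn1, hnZ⟩ := mem_Icc.1 hn
  have hle : radical n ≤ Z := (Nat.le_of_dvd hn1 radical_dvd_self).trans hnZ
  exact mem_sieveSupport.2
    ⟨squarefree_radical.dvd_primorial.trans (primorial_dvd_primorial hle), hle⟩

theorem log_le_selbergMass (a b : ℝ) (Z : ℕ) :
    Real.log (Z + 1) ≤ selbergMass (intervalSieve a b Z) Z := by
  have hharmonic : Real.log (Z + 1) ≤ ∑ n ∈ Icc 1 Z, (n : ℝ)⁻¹ := by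
    have h := log_add_one_le_harmonic Z
    rw [harmonic_eq_sum_Icc] at h
    push_cast at h
    exact h
  refine hharmonic.trans ?_
  rw [← sum_fiberwise_of_maps_to fun n hn => radical_mem_sieveSupport (a := a) (b := b) hn]
  refine sum_le_sum fun k _ => ?_
  rw [selbergTerms_apply]
  refine sum_inv_le_of_radical_eq _ fun n hn => ?_
  obtain ⟨hn, hrad⟩ := mem_filter.1 hn
  exact ⟨Nat.one_le_iff_ne_zero.1 (mem_Icc.1 hn).1, hrad⟩

theorem siftedSum_intervalSieve_le {a b : ℝ} (ha : 0 ≤ a) (hab : a < b) {Z : ℕ} (hZ : 1 ≤ Z) :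
    (intervalSieve a b Z).siftedSum ≤ (b - a) / Real.log (Z + 1) + (Z : ℝ) ^ 2 := by
  have hlog : 0 < Real.log (Z + 1) := Real.log_pos (by exact_mod_cast Nat.lt_succ_of_le hZ)
  have hcard : #(sieveSupport (intervalSieve a b Z) Z) ≤ Z := by
    refine (card_le_card fun d hd => ?_).trans_eq (Nat.card_Icc 1 Z)
    obtain ⟨hdvd, hle⟩ := mem_sieveSupport.1 hd
    exact mem_Icc.2 ⟨Nat.pos_of_dvd_of_pos hdvd (primorial_pos Z), hle⟩
  have hpos : ∀ d ∈ sieveSupport (intervalSieve a b Z) Z, 0 < d := fun d hd =>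
    Nat.pos_of_dvd_of_pos (mem_sieveSupport.1 hd).1 (primorial_pos Z)
  refine (siftedSum_le hZ).trans (add_le_add ?_ ?_)
  · exact div_le_div_of_nonneg_left (sub_nonneg.2 hab.le) hlog (log_le_selbergMass a b Z)
  · calc ∑ d ∈ sieveSupport (intervalSieve a b Z) Z, ∑ e ∈ sieveSupport (intervalSieve a b Z) Z,
          |(intervalSieve a b Z).rem (d.lcm e)|
        ≤ ∑ _d ∈ sieveSupport (intervalSieve a b Z) Z,
            ∑ _e ∈ sieveSupport (intervalSieve a b Z) Z, 1 :=
          sum_le_sum fun d hd => sum_le_sum fun e he =>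
            abs_rem_intervalSieve_le_one ha hab (Nat.lcm_pos (hpos d hd) (hpos e he))
      _ = (#(sieveSupport (intervalSieve a b Z) Z) : ℝ) ^ 2 := by simp [sq]
      _ ≤ (Z : ℝ) ^ 2 := by gcongr

theorem card_le_siftedSum_intervalSieve {a b : ℝ} (ha : 0 ≤ a) {Z : ℕ} (hZ : Z ≤ a) (T : Finset ℕ)
    (hT : ∀ n ∈ T, n.Prime ∧ a < n ∧ (n : ℝ) < b) :
    (#T : ℝ) ≤ (intervalSieve a b Z).siftedSum := by
  have hsubset : T ⊆ {n ∈ natsIn a b | Nat.Coprime (primorial Z) n} := fun n hn => by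
    obtain ⟨hp, han, hnb⟩ := hT n hn
    have hZn : Z < n := by exact_mod_cast hZ.trans_lt han
    refine mem_filter.2 ⟨(mem_natsIn ha).2 ⟨han, hnb⟩, ?_⟩
    rw [Nat.coprime_comm, hp.coprime_iff_not_dvd, hp.dvd_primorial_iff]
    exact hZn.not_ge
  rw [siftedSum, ← sum_filter]
  simp only [intervalSieve, Pi.one_apply, sum_const, nsmul_eq_mul, mul_one]
  exact_mod_cast card_le_card hsubset

/-- A Brun–Titchmarsh inequality, from sifting by the primes up to `h^(1/3)`. -/
theorem card_primes_le {a b h κ : ℝ} (hab : a < b) (hh : 1 < h) (hha : h ≤ a)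
    (hlen : b - a ≤ κ * h) (T : Finset ℕ) (hT : ∀ n ∈ T, n.Prime ∧ a < n ∧ (n : ℝ) < b) :
    (#T : ℝ) ≤ (3 * κ + 1.11) * h / Real.log h := by
  have hlog : 0 < Real.log h := Real.log_pos hh
  set z : ℝ := Real.exp (Real.log h / 3) with hz
  set Z : ℕ := ⌊z⌋₊
  have hz1 : 1 ≤ z := Real.one_le_exp (by positivity)
  have hz3 : z ^ 3 = h := by
    rw [hz, ← Real.exp_nat_mul, Nat.cast_ofNat, mul_div_cancel₀ _ (three_ne_zero' ℝ),
      Real.exp_log (zero_lt_one.trans hh)]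
  have hZ1 : 1 ≤ Z := Nat.le_floor (by exact_mod_cast hz1)
  have hZz : (Z : ℝ) ≤ z := Nat.floor_le (zero_le_one.trans hz1)
  have hzh : z ≤ h := hz3 ▸ le_self_pow₀ hz1 three_ne_zero
  have hlogZ : Real.log h / 3 ≤ Real.log (Z + 1) :=
    (Real.le_log_iff_exp_le (by positivity)).2 (Nat.lt_floor_add_one z).le
  have hmain : (b - a) / Real.log (Z + 1) ≤ 3 * κ * h / Real.log h := by
    calc (b - a) / Real.log (Z + 1) ≤ κ * h / (Real.log h / 3) := by
          gcongr
          exact (sub_nonneg.2 hab.le).trans hlen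
      _ = 3 * κ * h / Real.log h := by field_simp
  have herr : (Z : ℝ) ^ 2 ≤ 1.11 * h / Real.log h := by
    have hexp : Real.exp 1 * (Real.log h / 3) ≤ z := Real.exp_one_mul_le_exp
    have hlogz : Real.log h ≤ 1.11 * z := by nlinarith [Real.exp_one_gt_d9]
    rw [le_div_iff₀ hlog]
    calc (Z : ℝ) ^ 2 * Real.log h ≤ z ^ 2 * (1.11 * z) := by gcongr
      _ = 1.11 * h := by rw [← hz3]; ring
  have ha : 0 ≤ a := zero_le_one.trans (hh.le.trans hha)
  calc (#T : ℝ) ≤ (intervalSieve a b Z).siftedSum :=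
        card_le_siftedSum_intervalSieve ha (hZz.trans (hzh.trans hha)) T hT
    _ ≤ (b - a) / Real.log (Z + 1) + (Z : ℝ) ^ 2 := siftedSum_intervalSieve_le ha hab hZ1
    _ ≤ 3 * κ * h / Real.log h + 1.11 * h / Real.log h := add_le_add hmain herr
    _ = (3 * κ + 1.11) * h / Real.log h := by ring

end SelbergUpperBound

namespace LoganPi

open Finset SelbergUpperBound

theorem abs_exp_sub_linear_le {u : ℝ} (hu : |u| ≤ 1) :
    |Real.exp u - (1 + u)| ≤ 3 / 4 * u ^ 2 := by
  have h := Real.exp_bound hu (n := 2) two_pos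
  rw [sq_abs] at h
  norm_num [sum_range_succ, Nat.factorial] at h
  linarith

theorem abs_exp_sub_quadratic_le {u : ℝ} (hu : |u| ≤ 1) :
    |Real.exp u - (1 + u + u ^ 2 / 2)| ≤ 2 / 9 * |u| ^ 3 := by
  have h := Real.exp_bound hu (n := 3) three_pos
  norm_num [sum_range_succ, Nat.factorial] at h
  linarith

theorem abs_exp_sub_cubic_le {u : ℝ} (hu : |u| ≤ 1) :
    |Real.exp u - (1 + u + u ^ 2 / 2 + u ^ 3 / 6)| ≤ 5 / 96 * u ^ 4 := by
  have h := Real.exp_bound hu (n := 4) four_pos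
  rw [Even.pow_abs (by decide)] at h
  norm_num [sum_range_succ, Nat.factorial] at h
  linarith

theorem exp_sub_exp_neg_le {ε : ℝ} (hε₀ : 0 ≤ ε) (hε : ε ≤ 1 / 10 ^ 3) :
    Real.exp ε - Real.exp (-ε) ≤ 2.001 * ε := by
  have habs : |ε| = ε := abs_of_nonneg hε₀
  have hle : |ε| ≤ 1 := by rw [habs]; linarith
  have hpos := (abs_le.1 (abs_exp_sub_quadratic_le hle)).2
  have hneg := (abs_le.1 (abs_exp_sub_quadratic_le ((abs_neg ε).trans_le hle))).1
  rw [habs] at hpos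
  rw [abs_neg, habs] at hneg
  have hcube : ε ^ 3 ≤ ε * (1 / 10 ^ 3) ^ 2 := by
    calc ε ^ 3 = ε * ε ^ 2 := by ring
      _ ≤ ε * (1 / 10 ^ 3) ^ 2 := by gcongr
  linarith

theorem log_exp_mul {x : ℝ} (hx : 0 < x) (δ : ℝ) :
    Real.log (Real.exp δ * x) = δ + Real.log x := by
  rw [Real.log_mul (Real.exp_pos δ).ne' hx.ne', Real.log_exp]

theorem log_two_mul_sq {x : ℝ} (hx : 0 < x) :
    Real.log (2 * x ^ 2) = Real.log 2 + 2 * Real.log x := by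
  rw [Real.log_mul two_ne_zero (by positivity), Real.log_pow, Nat.cast_ofNat]

theorem one_le_log_two_mul_sq {x : ℝ} (hx : 2 ≤ x) : 1 ≤ Real.log (2 * x ^ 2) := by
  rw [Real.le_log_iff_exp_le (by positivity)]
  nlinarith [Real.exp_one_lt_d9]

theorem PP.val_eq_cast (q : PP) : q.val = (((q.1 : ℕ) ^ (q.2 : ℕ) : ℕ) : ℝ) := by
  simp [PP.val, PP.p, PP.m]

theorem PP.m_pos (q : PP) : 0 < q.m := q.2.pos

theorem PP.two_le_p (q : PP) : 2 ≤ q.p := Nat.ofNat_le_cast.2 q.1.2.two_le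

theorem PP.two_le_val (q : PP) : 2 ≤ q.val :=
  q.two_le_p.trans (le_self_pow₀ (one_le_two.trans q.two_le_p) q.m_pos.ne')

theorem PP.val_pos (q : PP) : 0 < q.val := two_pos.trans_le q.two_le_val

theorem PP.log_val (q : PP) : Real.log q.val = q.m * Real.log q.p := Real.log_pow _ _

theorem PP.log_two_le_log_val (q : PP) : Real.log 2 ≤ Real.log q.val :=
  Real.log_le_log two_pos q.two_le_val

theorem PP.m_mul_log_two_le (q : PP) : q.m * Real.log 2 ≤ Real.log q.val := by
  rw [q.log_val]
  gcongr
  exact q.two_le_p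

theorem PP.pow_injective : Function.Injective fun q : PP => (q.1 : ℕ) ^ (q.2 : ℕ) := by
  rintro ⟨p, m⟩ ⟨p', m'⟩ h
  change (p : ℕ) ^ (m : ℕ) = (p' : ℕ) ^ (m' : ℕ) at h
  obtain rfl : p = p' := Subtype.ext <| (Nat.prime_dvd_prime_iff_eq p.2 p'.2).1 <|
    p.2.dvd_of_dvd_pow (h ▸ dvd_pow_self (p : ℕ) m.pos.ne' : (p : ℕ) ∣ (p' : ℕ) ^ (m' : ℕ))
  exact congrArg (Prod.mk p) (PNat.coe_injective (Nat.pow_right_injective p.2.two_le h))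

theorem card_le_of_forall_le {y : ℝ} (hy : 0 ≤ y) {T : Finset ℕ}
    (hT : ∀ n ∈ T, n ≠ 0 ∧ (n : ℝ) ≤ y) : (#T : ℝ) ≤ y := by
  have hsubset : T ⊆ Icc 1 ⌊y⌋₊ := fun n hn =>
    mem_Icc.2 ⟨Nat.one_le_iff_ne_zero.2 (hT n hn).1, Nat.le_floor (hT n hn).2⟩
  have hcard : #T ≤ ⌊y⌋₊ := (card_le_card hsubset).trans_eq (Nat.card_Icc 1 _)
  exact (Nat.cast_le.2 hcard).trans (Nat.floor_le hy)

theorem sum_inv_log_le_of_le_sqrt {x : ℝ} (hx : 16 ≤ x) {T : Finset ℕ}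
    (hT : ∀ n ∈ T, 2 ≤ n ∧ (n : ℝ) ≤ √x) : ∑ n ∈ T, (Real.log n)⁻¹ ≤ x / Real.log x := by
  have hx0 : 0 < x := by linarith
  have hlog2 : 0 < Real.log 2 := Real.log_pos one_lt_two
  have hlogx : 0 < Real.log x := Real.log_pos (by linarith)
  have hterm : ∀ n ∈ T, (Real.log n)⁻¹ ≤ (Real.log 2)⁻¹ := fun n hn =>
    inv_anti₀ hlog2 (Real.log_le_log two_pos (Nat.ofNat_le_cast.2 (hT n hn).1))
  have hsqrt : Real.log x ≤ Real.log 2 * √x := by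
    have hexp : Real.exp 2 ≤ 16 := by
      rw [← Real.le_log_iff_exp_le (by norm_num), show (16 : ℝ) = 2 ^ 4 by norm_num, Real.log_pow,
        Nat.cast_ofNat]
      linarith [Real.log_two_gt_d9]
    have hanti : Real.log x / √x ≤ Real.log 16 / √16 :=
      Real.log_div_sqrt_antitoneOn hexp (hexp.trans hx) hx
    have hsqrt16 : √(16 : ℝ) = 4 := by rw [Real.sqrt_eq_iff_mul_self_eq] <;> norm_num
    have hlog16 : Real.log 16 = 4 * Real.log 2 := by
      rw [show (16 : ℝ) = 2 ^ 4 by norm_num, Real.log_pow]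
      norm_num
    rw [hsqrt16, hlog16, mul_div_cancel_left₀ _ four_ne_zero] at hanti
    exact (div_le_iff₀ (Real.sqrt_pos.2 hx0)).1 hanti
  calc ∑ n ∈ T, (Real.log n)⁻¹ ≤ #T * (Real.log 2)⁻¹ := by
        rw [← nsmul_eq_mul]
        exact sum_le_card_nsmul _ _ _ hterm
    _ ≤ √x * (Real.log 2)⁻¹ := by
        gcongr
        exact card_le_of_forall_le (Real.sqrt_nonneg x)
          fun n hn => ⟨(two_pos.trans_le (hT n hn).1).ne', (hT n hn).2⟩
    _ ≤ x / Real.log x := by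
        rw [← div_eq_mul_inv, div_le_div_iff₀ hlog2 hlogx]
        calc √x * Real.log x ≤ √x * (Real.log 2 * √x) := by gcongr
          _ = (√x * √x) * Real.log 2 := by ring
          _ = x * Real.log 2 := by rw [Real.mul_self_sqrt hx0.le]

theorem sum_inv_log_le_of_sqrt_lt {x : ℝ} (hx : 1 < x) {T : Finset ℕ}
    (hT : ∀ n ∈ T, √x < n ∧ (n : ℝ) ≤ x) : ∑ n ∈ T, (Real.log n)⁻¹ ≤ 2 * x / Real.log x := by
  have hx0 : 0 < x := by linarith
  have hlogx : 0 < Real.log x := Real.log_pos hx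
  have hsqrt : 0 < √x := Real.sqrt_pos.2 hx0
  have hterm : ∀ n ∈ T, (Real.log n)⁻¹ ≤ (Real.log x / 2)⁻¹ := fun n hn => by
    rw [← Real.log_sqrt hx0.le]
    exact inv_anti₀ (by rw [Real.log_sqrt hx0.le]; positivity)
      (Real.log_le_log hsqrt (hT n hn).1.le)
  calc ∑ n ∈ T, (Real.log n)⁻¹ ≤ #T * (Real.log x / 2)⁻¹ := by
        rw [← nsmul_eq_mul]
        exact sum_le_card_nsmul _ _ _ hterm
    _ ≤ x * (Real.log x / 2)⁻¹ := by
        gcongr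
        exact card_le_of_forall_le hx0.le fun n hn =>
          ⟨Nat.cast_ne_zero.1 (hsqrt.trans (hT n hn).1).ne', (hT n hn).2⟩
    _ = 2 * x / Real.log x := by field_simp

theorem sum_inv_log_le {x : ℝ} (hx : 16 ≤ x) (T : Finset ℕ)
    (hT : ∀ n ∈ T, 2 ≤ n ∧ (n : ℝ) ≤ x) : ∑ n ∈ T, (Real.log n)⁻¹ ≤ 3 * x / Real.log x := by
  rw [← sum_filter_add_sum_filter_not T (fun n : ℕ => (n : ℝ) ≤ √x)]
  calc _ ≤ x / Real.log x + 2 * x / Real.log x := by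
        refine add_le_add (sum_inv_log_le_of_le_sqrt hx fun n hn => ?_)
          (sum_inv_log_le_of_sqrt_lt (by linarith) fun n hn => ?_)
        · exact ⟨(hT n (mem_filter.1 hn).1).1, (mem_filter.1 hn).2⟩
        · exact ⟨not_le.1 (mem_filter.1 hn).2, (hT n (mem_filter.1 hn).1).2⟩
    _ = 3 * x / Real.log x := by ring

theorem sum_inv_log_val_le {x : ℝ} (hx : 16 ≤ x) (F : Finset PP) (hF : ∀ q ∈ F, q.val ≤ x) :
    ∑ q ∈ F, (Real.log q.val)⁻¹ ≤ 3 * x / Real.log x := by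
  have himage : ∀ n ∈ F.image fun q : PP => (q.1 : ℕ) ^ (q.2 : ℕ), 2 ≤ n ∧ (n : ℝ) ≤ x := by
    intro n hn
    obtain ⟨q, hq, rfl⟩ := mem_image.1 hn
    rw [← PP.val_eq_cast]
    refine ⟨?_, hF q hq⟩
    exact_mod_cast q.val_eq_cast ▸ q.two_le_val
  have h := sum_inv_log_le hx _ himage
  rw [sum_image PP.pow_injective.injOn] at h
  simpa only [PP.val_eq_cast] using h

theorem card_pow_mem_le {x ε : ℝ} (hx : 1 ≤ x) (hε₀ : 0 < ε) (hε : ε ≤ 1 / 10 ^ 3) {m : ℕ}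
    (hm : 2 ≤ m) (T : Finset ℕ)
    (hT : ∀ n ∈ T, Real.exp (-ε) * x < (n : ℝ) ^ m ∧ (n : ℝ) ^ m < Real.exp ε * x) :
    (#T : ℝ) ≤ 1 + 1.01 * ε * √x := by
  set y : ℝ := x ^ ((m : ℝ)⁻¹) with hy
  have hm0 : (m : ℝ) ≠ 0 := Nat.cast_ne_zero.2 (two_pos.trans_le hm).ne'
  have hεm : ε / m ≤ ε / 2 := by gcongr; exact_mod_cast hm
  have hpow : ∀ s : ℝ, (Real.exp (s / m) * y) ^ m = Real.exp s * x := fun s => by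
    rw [mul_pow, Real.rpow_inv_natCast_pow (by linarith) (by lia), ← Real.exp_nat_mul,
      mul_div_cancel₀ _ hm0]
  have hlt : Real.exp (-ε / m) * y < Real.exp (ε / m) * y := by
    gcongr
    linarith
  have hsubset : T ⊆ natsIn (Real.exp (-ε / m) * y) (Real.exp (ε / m) * y) := fun n hn => by
    have h := hT n hn
    rw [← hpow, ← hpow] at h
    exact (mem_natsIn (by positivity)).2 ⟨lt_of_pow_lt_pow_left₀ m n.cast_nonneg h.1,
      lt_of_pow_lt_pow_left₀ m (by positivity) h.2⟩
  have hroot : y ≤ √x := by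
    rw [hy, Real.sqrt_eq_rpow, one_div]
    refine Real.rpow_le_rpow_of_exponent_le hx (inv_anti₀ two_pos ?_)
    exact_mod_cast hm
  have hdiff := exp_sub_exp_neg_le (ε := ε / m) (by positivity) (by linarith)
  have hcard := (abs_le.1 (abs_card_natsIn_sub_le (by positivity) hlt)).2
  calc (#T : ℝ) ≤ #(natsIn (Real.exp (-ε / m) * y) (Real.exp (ε / m) * y)) := by
        exact_mod_cast card_le_card hsubset
    _ ≤ 1 + (Real.exp (ε / m) - Real.exp (-(ε / m))) * y := by rw [← neg_div]; linarith
    _ ≤ 1 + 1.01 * ε * √x := by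
        gcongr
        linarith

theorem card_filter_m_eq_image (F : Finset PP) (m : ℕ) :
    #({q ∈ F | q.m = m}.image fun q : PP => (q.1 : ℕ)) = #{q ∈ F | q.m = m} := by
  refine card_image_of_injOn fun q hq q' hq' h => ?_
  exact Prod.ext (Subtype.ext h) (PNat.coe_injective
    ((mem_filter.1 hq).2.trans (mem_filter.1 hq').2.symm))

theorem sum_inv_m_eq_sum_card {M : ℕ} (F : Finset PP) (hF : ∀ q ∈ F, q.m ≤ M) :
    ∑ q ∈ F, 1 / (q.m : ℝ) = ∑ m ∈ Icc 1 M, 1 / (m : ℝ) * #{q ∈ F | q.m = m} := by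
  rw [← sum_fiberwise_of_maps_to fun q hq => mem_Icc.2 ⟨q.m_pos, hF q hq⟩]
  refine sum_congr rfl fun m _ => ?_
  rw [sum_congr rfl fun q hq => by rw [(mem_filter.1 hq).2], sum_const, nsmul_eq_mul, mul_comm]

theorem sum_inv_Ioc_one_le_log {M : ℕ} (hM : 1 ≤ M) :
    ∑ m ∈ Ioc 1 M, (m : ℝ)⁻¹ ≤ Real.log M := by
  have h := harmonic_le_one_add_log M
  rw [harmonic_eq_sum_Icc, ← add_sum_Ioc_eq_sum_Icc hM] at h
  push_cast at h
  rw [inv_one] at h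
  exact le_of_add_le_add_left h

section Near

variable {x ε : ℝ} {F : Finset PP}

theorem card_filter_m_eq_one_le (hε₀ : 0 < ε) (hε : ε ≤ 1 / 10 ^ 3) (hεx : 1 < ε * x)
    (hF : ∀ q ∈ F, Real.exp (-ε) * x < q.val ∧ q.val < Real.exp ε * x) :
    (#{q ∈ F | q.m = 1} : ℝ) ≤ 7.2 * (ε * x) / Real.log (ε * x) := by
  have hx0 : 0 < x := pos_of_mul_pos_right (zero_lt_one.trans hεx) hε₀.le
  have hlog : 0 < Real.log (ε * x) := Real.log_pos hεx
  have hlt : Real.exp (-ε) * x < Real.exp ε * x := by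
    gcongr
    linarith
  have hstart : ε * x ≤ Real.exp (-ε) * x := by
    gcongr
    linarith [Real.add_one_le_exp (-ε)]
  have hlength : Real.exp ε * x - Real.exp (-ε) * x ≤ 2.001 * (ε * x) := by
    rw [← sub_mul, ← mul_assoc]
    gcongr
    exact exp_sub_exp_neg_le hε₀.le hε
  rw [← card_filter_m_eq_image]
  refine (card_primes_le hlt hεx hstart hlength _ fun n hn => ?_).trans ?_
  · obtain ⟨q, hq, rfl⟩ := mem_image.1 hn
    obtain ⟨hqF, hqm⟩ := mem_filter.1 hq
    have h := hF q hqF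
    rw [PP.val, hqm, pow_one] at h
    exact ⟨q.1.2, h⟩
  · gcongr
    norm_num

theorem card_filter_m_eq_le (hx : 1 ≤ x) (hε₀ : 0 < ε) (hε : ε ≤ 1 / 10 ^ 3)
    (hF : ∀ q ∈ F, Real.exp (-ε) * x < q.val ∧ q.val < Real.exp ε * x) {m : ℕ} (hm : 2 ≤ m) :
    (#{q ∈ F | q.m = m} : ℝ) ≤ 1 + 1.01 * ε * √x := by
  rw [← card_filter_m_eq_image]
  refine card_pow_mem_le hx hε₀ hε hm _ fun n hn => ?_
  obtain ⟨q, hq, rfl⟩ := mem_image.1 hn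
  obtain ⟨hqF, hqm⟩ := mem_filter.1 hq
  have h := hF q hqF
  rwa [PP.val, hqm] at h

theorem PP.m_le_log_of_val_lt {q : PP} (hx : 1 ≤ x) (hε : ε ≤ 1 / 10 ^ 3)
    (hq : q.val < Real.exp ε * x) : (q.m : ℝ) ≤ Real.log (2 * x ^ 2) := by
  have hx0 : 0 < x := zero_lt_one.trans_le hx
  have hlogx : 0 ≤ Real.log x := Real.log_nonneg hx
  have hval := Real.log_le_log q.val_pos hq.le
  rw [log_exp_mul hx0] at hval
  have hm := q.m_mul_log_two_le
  have hlog2 := Real.log_two_gt_d9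
  rw [log_two_mul_sq hx0]
  nlinarith [(Nat.cast_nonneg q.m : (0 : ℝ) ≤ q.m)]

theorem sum_inv_m_near_le (hx : 2 ≤ x) (hε : ε ≤ 1 / 10 ^ 3) (hε₀ : 0 < ε) (hεx : 1 < ε * x)
    (hF : ∀ q ∈ F, Real.exp (-ε) * x < q.val ∧ q.val < Real.exp ε * x) :
    ∑ q ∈ F, 1 / (q.m : ℝ) ≤ 7.2 * (ε * x) / Real.log (ε * x) +
      (1 + 1.01 * ε * √x) * Real.log (Real.log (2 * x ^ 2)) := by
  have hx1 : 1 ≤ x := by linarith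
  set M : ℕ := ⌊Real.log (2 * x ^ 2)⌋₊
  have hlog := one_le_log_two_mul_sq hx
  have hM : 1 ≤ M := Nat.le_floor (by exact_mod_cast hlog)
  rw [sum_inv_m_eq_sum_card F fun q hq => Nat.le_floor (PP.m_le_log_of_val_lt hx1 hε (hF q hq).2),
    ← add_sum_Ioc_eq_sum_Icc hM, Nat.cast_one, one_div_one, one_mul]
  refine add_le_add (card_filter_m_eq_one_le hε₀ hε hεx hF) ?_
  calc ∑ m ∈ Ioc 1 M, 1 / (m : ℝ) * #{q ∈ F | q.m = m}
      ≤ ∑ m ∈ Ioc 1 M, (1 + 1.01 * ε * √x) * (m : ℝ)⁻¹ := by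
        refine sum_le_sum fun m hm => ?_
        rw [mul_comm, one_div]
        gcongr
        exact card_filter_m_eq_le hx1 hε₀ hε hF (mem_Ioc.1 hm).1
    _ ≤ (1 + 1.01 * ε * √x) * Real.log (Real.log (2 * x ^ 2)) := by
        rw [← mul_sum]
        gcongr
        refine (sum_inv_Ioc_one_le_log hM).trans (Real.log_le_log (by exact_mod_cast hM) ?_)
        exact Nat.floor_le (by linarith)

end Near

end LoganPi

namespace LoganPi

section Expansion

variable {s y : ℝ}

theorem abs_mul_le_of_le (hs : 0 ≤ s) (hs' : s ≤ 1.45) (hy : |y| ≤ 1 / 10 ^ 3) :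
    |s * y| ≤ 0.00145 := by
  rw [abs_mul, abs_of_nonneg hs]
  calc s * |y| ≤ 1.45 * (1 / 10 ^ 3) := by gcongr
    _ = 0.00145 := by norm_num

theorem le_one_sub_mul (hs : 0 ≤ s) (hs' : s ≤ 1.45) (hy : |y| ≤ 1 / 10 ^ 3) :
    0.998 ≤ 1 - s * y := by
  linarith [(abs_le.1 (abs_mul_le_of_le hs hs' hy)).2]

theorem abs_neg_half_le (hy : |y| ≤ 1 / 10 ^ 3) : |-y / 2| ≤ 1 := by
  rw [abs_div, abs_neg, abs_two]
  linarith

/-- The remainder of the second-order Taylor expansion in `y` of `e^{-y/2} / (1 - s y)`, which is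
the contribution of `f₁` to the weight. -/
noncomputable def remainderOne (s y : ℝ) : ℝ :=
  Real.exp (-y / 2) / (1 - s * y) - (1 + (s - 1 / 2) * y + (s ^ 2 - s / 2 + 1 / 8) * y ^ 2)

/-- The remainder of the first-order Taylor expansion in `y` of
`e^{-y/2} ((1 - s y)⁻² - 2 s (1 - s y)⁻³)`, which is the contribution of `f₂ - 2 f₃` to the
weight. -/
noncomputable def remainderTwo (s y : ℝ) : ℝ :=
  Real.exp (-y / 2) * (1 - s * y - 2 * s) / (1 - s * y) ^ 3 -
    (1 - 2 * s + (-1 / 2 + 3 * s - 6 * s ^ 2) * y)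

theorem abs_remainderOne_le (hs : 0 ≤ s) (hs' : s ≤ 1.45) (hy : |y| ≤ 1 / 10 ^ 3) :
    |remainderOne s y| ≤ 1.01 * (1 / 30 + s * (s ^ 2 - s / 2 + 1 / 8)) * |y| ^ 3 := by
  have hden := le_one_sub_mul hs hs' hy
  have hcoeff : 0 < s ^ 2 - s / 2 + 1 / 8 := by nlinarith [sq_nonneg (s - 1 / 4)]
  have hexp := abs_exp_sub_quadratic_le (abs_neg_half_le hy)
  rw [show |-y / 2| = |y| / 2 by rw [abs_div, abs_neg, abs_two]] at hexp
  have heq : remainderOne s y =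
      ((Real.exp (-y / 2) - (1 + -y / 2 + (-y / 2) ^ 2 / 2)) +
        s * (s ^ 2 - s / 2 + 1 / 8) * y ^ 3) / (1 - s * y) := by
    have hne : 1 - s * y ≠ 0 := by linarith
    rw [remainderOne, eq_div_iff hne, sub_mul, div_mul_cancel₀ _ hne]
    ring
  have hcube : |s * (s ^ 2 - s / 2 + 1 / 8) * y ^ 3| =
      s * (s ^ 2 - s / 2 + 1 / 8) * |y| ^ 3 := by
    rw [abs_mul, abs_of_nonneg (by positivity), abs_pow]
  have hy3 : 0 ≤ |y| ^ 3 := by positivity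
  have hnum : 0 ≤ (1 / 30 + s * (s ^ 2 - s / 2 + 1 / 8)) * |y| ^ 3 := by positivity
  rw [heq, abs_div, abs_of_pos (by linarith : 0 < 1 - s * y), div_le_iff₀ (by linarith)]
  calc _ ≤ 2 / 9 * (|y| / 2) ^ 3 + s * (s ^ 2 - s / 2 + 1 / 8) * |y| ^ 3 :=
        (abs_add_le _ _).trans (add_le_add hexp hcube.le)
    _ ≤ 1.01 * ((1 / 30 + s * (s ^ 2 - s / 2 + 1 / 8)) * |y| ^ 3) * 0.998 := by nlinarith
    _ ≤ 1.01 * (1 / 30 + s * (s ^ 2 - s / 2 + 1 / 8)) * |y| ^ 3 * (1 - s * y) := by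
        rw [← mul_assoc]
        gcongr

theorem abs_linearCoeff_le (hs : 0 ≤ s) (hs' : s ≤ 1.45) :
    |-1 / 2 + 3 * s - 6 * s ^ 2| ≤ 10 := by
  rw [abs_le]
  constructor <;> nlinarith

-- With `z = s y`, this is the cofactor of `y ^ 2` in `remainderTwo_eq`.
theorem abs_quadraticCoeff_le {z : ℝ} (hs : 0 ≤ s) (hs' : s ≤ 1.45) (hz : |z| ≤ 0.00145) :
    |-s + 6 * s ^ 2 - 12 * s ^ 3 + s ^ 2 * z * (1 - 2 * s) -
      3 * s * z * (-1 / 2 + 3 * s - 6 * s ^ 2) + z ^ 2 * s * (-1 / 2 + 3 * s - 6 * s ^ 2)| ≤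
      31.12 := by
  have hlinear := abs_linearCoeff_le hs hs'
  have hconst : |-s + 6 * s ^ 2 - 12 * s ^ 3| ≤ 31 := by
    have hfactor : -s + 6 * s ^ 2 - 12 * s ^ 3 = -(s * (1 - 6 * s + 12 * s ^ 2)) := by ring
    have hpos : 0 < 1 - 6 * s + 12 * s ^ 2 := by nlinarith [sq_nonneg (s - 1 / 4)]
    have hle : 1 - 6 * s + 12 * s ^ 2 ≤ 20 := by nlinarith
    rw [hfactor, abs_neg, abs_of_nonneg (by positivity)]
    nlinarith
  have hfirst : |s ^ 2 * z * (1 - 2 * s)| ≤ 0.01 := by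
    have h : |1 - 2 * s| ≤ 2 := by rw [abs_le]; constructor <;> linarith
    rw [abs_mul, abs_mul, abs_of_nonneg (by positivity : 0 ≤ s ^ 2)]
    calc s ^ 2 * |z| * |1 - 2 * s| ≤ 1.45 ^ 2 * 0.00145 * 2 := by gcongr
      _ ≤ 0.01 := by norm_num
  have hsecond : |3 * s * z * (-1 / 2 + 3 * s - 6 * s ^ 2)| ≤ 0.1 := by
    rw [abs_mul, abs_mul, abs_of_nonneg (by positivity : 0 ≤ 3 * s)]
    calc 3 * s * |z| * |-1 / 2 + 3 * s - 6 * s ^ 2| ≤ 3 * 1.45 * 0.00145 * 10 := by gcongr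
      _ ≤ 0.1 := by norm_num
  have hthird : |z ^ 2 * s * (-1 / 2 + 3 * s - 6 * s ^ 2)| ≤ 0.01 := by
    rw [abs_mul, abs_mul, abs_pow, abs_of_nonneg hs]
    calc |z| ^ 2 * s * |-1 / 2 + 3 * s - 6 * s ^ 2| ≤ 0.00145 ^ 2 * 1.45 * 10 := by gcongr
      _ ≤ 0.01 := by norm_num
  rw [abs_le] at *
  constructor <;> linarith

theorem remainderTwo_eq (h : 1 - s * y ≠ 0) :
    remainderTwo s y = ((Real.exp (-y / 2) - (1 + -y / 2)) * (1 - s * y - 2 * s) + y ^ 2 *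
      (-s + 6 * s ^ 2 - 12 * s ^ 3 + s ^ 2 * (s * y) * (1 - 2 * s) -
        3 * s * (s * y) * (-1 / 2 + 3 * s - 6 * s ^ 2) +
        (s * y) ^ 2 * s * (-1 / 2 + 3 * s - 6 * s ^ 2))) / (1 - s * y) ^ 3 := by
  have hne : (1 - s * y) ^ 3 ≠ 0 := pow_ne_zero 3 h
  rw [remainderTwo, eq_div_iff hne, sub_mul, div_mul_cancel₀ _ hne]
  ring

theorem abs_remainderTwo_le (hs : 0 ≤ s) (hs' : s ≤ 1.45) (hy : |y| ≤ 1 / 10 ^ 3) :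
    |remainderTwo s y| ≤ 32 * y ^ 2 := by
  have hden := le_one_sub_mul hs hs' hy
  have hz := abs_mul_le_of_le hs hs' hy
  have hden3 : 0.99 ≤ (1 - s * y) ^ 3 := by
    calc (0.99 : ℝ) ≤ 0.998 ^ 3 := by norm_num
      _ ≤ (1 - s * y) ^ 3 := by gcongr
  have hexp := abs_exp_sub_linear_le (abs_neg_half_le hy)
  have hfactor : |1 - s * y - 2 * s| ≤ 2 := by
    have := abs_le.1 hz
    rw [abs_le]
    constructor <;> linarith
  rw [remainderTwo_eq (by linarith), abs_div, abs_of_pos (by linarith : 0 < (1 - s * y) ^ 3),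
    div_le_iff₀ (by linarith)]
  calc _ ≤ 3 / 4 * (-y / 2) ^ 2 * 2 + y ^ 2 * 31.12 := by
        refine (abs_add_le _ _).trans ?_
        rw [abs_mul, abs_mul (y ^ 2), abs_of_nonneg (sq_nonneg y)]
        gcongr
        exact abs_quadraticCoeff_le hs hs' hz
    _ ≤ 32 * y ^ 2 * 0.99 := by nlinarith [sq_nonneg y]
    _ ≤ 32 * y ^ 2 * (1 - s * y) ^ 3 := by gcongr

/-- The integrand `t e^{-t/2} (f₁ + A (f₂ - 2 f₃))(t - y)` of the convolution defining the weight
`φ`, as a function of `s = 1 / t`; see `transferKernel_inv_eq`. -/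
noncomputable def transferKernel (s A y : ℝ) : ℝ :=
  Real.exp (-y / 2) / (1 - s * y) +
    A * s * (Real.exp (-y / 2) * (1 - s * y - 2 * s) / (1 - s * y) ^ 3)

theorem transferKernel_inv_eq {t : ℝ} (A : ℝ) (ht : t ≠ 0) (hty : t - y ≠ 0) :
    transferKernel t⁻¹ A y =
      t * Real.exp (-t / 2) * (f 1 (t - y) + A * (f 2 (t - y) - 2 * f 3 (t - y))) := by
  have hexp : Real.exp (-y / 2) = Real.exp (-t / 2) * Real.exp ((t - y) / 2) := by
    rw [← Real.exp_add]
    ring_nf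
  have hden : 1 - t⁻¹ * y = (t - y) / t := by field_simp
  simp only [transferKernel, f, hden, hexp]
  generalize t - y = z at *
  field_simp

theorem measurable_transferKernel (s A : ℝ) : Measurable (transferKernel s A) := by
  unfold transferKernel
  fun_prop

theorem continuousOn_transferKernel (A : ℝ) (hs : 0 ≤ s) (hs' : s ≤ 1.45) {ε : ℝ}
    (hε : ε ≤ 1 / 10 ^ 3) : ContinuousOn (transferKernel s A) (Set.Icc (-ε) ε) := by
  have hne : ∀ y ∈ Set.Icc (-ε) ε, 1 - s * y ≠ 0 := fun y hy => by
    linarith [le_one_sub_mul hs hs' ((abs_le.2 hy).trans hε)]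
  have hexp : ContinuousOn (fun y => Real.exp (-y / 2)) (Set.Icc (-ε) ε) := by fun_prop
  exact (hexp.div (by fun_prop) hne).add (continuousOn_const.mul
    ((hexp.mul (by fun_prop)).div (by fun_prop) fun y hy => pow_ne_zero 3 (hne y hy)))

theorem abs_transferKernel_sub_exp_le {A : ℝ} (hA : 0 ≤ A) (hs : 0 ≤ s) (hs' : s ≤ 1.45)
    (hy : |y| ≤ 1 / 10 ^ 3) :
    |transferKernel s A y - Real.exp (-y / 2) - (A * s * (1 - 2 * s) +
      (s + A * s * (-1 / 2 + 3 * s - 6 * s ^ 2)) * y + s * (s - 1 / 2) * y ^ 2 +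
      s * (s ^ 2 - s / 2 + 1 / 8) * y ^ 3)| ≤ s * (2.25 * y ^ 4) + A * s * (32 * y ^ 2) := by
  have hden : 1 - s * y ≠ 0 := by linarith [le_one_sub_mul hs hs' hy]
  have heq : transferKernel s A y - Real.exp (-y / 2) - (A * s * (1 - 2 * s) +
      (s + A * s * (-1 / 2 + 3 * s - 6 * s ^ 2)) * y + s * (s - 1 / 2) * y ^ 2 +
      s * (s ^ 2 - s / 2 + 1 / 8) * y ^ 3) =
        s * (y * remainderOne s y) + A * s * remainderTwo s y := by
    rw [transferKernel, remainderOne, remainderTwo]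
    linear_combination div_mul_cancel₀ (Real.exp (-y / 2)) hden
  have hcoeff : 1.01 * (1 / 30 + s * (s ^ 2 - s / 2 + 1 / 8)) ≤ 2.25 := by
    have : s ^ 2 - s / 2 + 1 / 8 ≤ 1.51 := by nlinarith
    nlinarith
  have hone : |y * remainderOne s y| ≤ 2.25 * y ^ 4 := by
    calc |y * remainderOne s y| ≤ |y| * (2.25 * |y| ^ 3) := by
          rw [abs_mul]
          gcongr
          exact (abs_remainderOne_le hs hs' hy).trans (by gcongr)
      _ = 2.25 * (|y| ^ 2) ^ 2 := by ring
      _ = 2.25 * y ^ 4 := by rw [sq_abs]; ring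
  rw [heq]
  refine (abs_add_le _ _).trans ?_
  rw [abs_mul s, abs_mul (A * s), abs_of_nonneg hs, abs_of_nonneg (by positivity : 0 ≤ A * s)]
  gcongr
  exact abs_remainderTwo_le hs hs' hy

/-- The part of the expansion of `transferKernel` at `y = 0` that is of second order, counting
`A` as second order. -/
noncomputable def quadPart (s A y : ℝ) : ℝ :=
  (s ^ 2 - s / 2 + 1 / 8) * y ^ 2 + A * s * (1 - 2 * s)

theorem quadPart_neg (s A y : ℝ) : quadPart s A (-y) = quadPart s A y := by
  rw [quadPart, quadPart, neg_sq]

theorem quadPart_nonneg {A : ℝ} (hs : 0 ≤ s) (hs' : s ≤ 1 / 2) (hA : 0 ≤ A) (y : ℝ) :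
    0 ≤ quadPart s A y := by
  have hcoeff : 0 ≤ s ^ 2 - s / 2 + 1 / 8 := by nlinarith [sq_nonneg (s - 1 / 4)]
  have hconst : 0 ≤ 1 - 2 * s := by linarith
  rw [quadPart]
  positivity

theorem continuous_quadPart (s A : ℝ) : Continuous (quadPart s A) := by
  unfold quadPart
  fun_prop

theorem abs_transferKernel_sub_quadPart_le {A : ℝ} (hA : 0 ≤ A) (hs : 0 ≤ s) (hs' : s ≤ 0.11)
    (hy : |y| ≤ 1 / 10 ^ 3) :
    |transferKernel s A y - (1 + (s - 1 / 2) * y + quadPart s A y)| ≤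
      |y| * (0.06 * A + 0.05 * y ^ 2) := by
  have hs2 : s ≤ 1.45 := hs'.trans (by norm_num)
  have heq : transferKernel s A y - (1 + (s - 1 / 2) * y + quadPart s A y) =
      remainderOne s y +
        A * s * (remainderTwo s y + (-1 / 2 + 3 * s - 6 * s ^ 2) * y) := by
    rw [quadPart, transferKernel, remainderOne, remainderTwo]
    ring
  have hcoeff : 1.01 * (1 / 30 + s * (s ^ 2 - s / 2 + 1 / 8)) ≤ 0.05 := by
    have : s ^ 2 - s / 2 + 1 / 8 ≤ 1 / 8 := by nlinarith
    nlinarith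
  have hone : |remainderOne s y| ≤ |y| * (0.05 * y ^ 2) := by
    calc |remainderOne s y| ≤ 0.05 * |y| ^ 3 :=
          (abs_remainderOne_le hs hs2 hy).trans (by gcongr)
      _ = |y| * (0.05 * |y| ^ 2) := by ring
      _ = |y| * (0.05 * y ^ 2) := by rw [sq_abs]
  have hlinear : |-1 / 2 + 3 * s - 6 * s ^ 2| ≤ 0.5 := by
    rw [abs_le]
    constructor <;> nlinarith
  have hsq : y ^ 2 ≤ 1 / 10 ^ 3 * |y| := by
    rw [← sq_abs, sq]
    gcongr
  have htwo : |remainderTwo s y + (-1 / 2 + 3 * s - 6 * s ^ 2) * y| ≤ 0.54 * |y| := by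
    calc _ ≤ 32 * y ^ 2 + 0.5 * |y| := by
          refine (abs_add_le _ _).trans ?_
          rw [abs_mul]
          gcongr
          exact abs_remainderTwo_le hs hs2 hy
      _ ≤ 0.54 * |y| := by linarith [abs_nonneg y]
  rw [heq]
  calc _ ≤ |y| * (0.05 * y ^ 2) + A * 0.11 * (0.54 * |y|) := by
        refine (abs_add_le _ _).trans ?_
        rw [abs_mul (A * s), abs_of_nonneg (by positivity : 0 ≤ A * s)]
        gcongr
    _ ≤ |y| * (0.06 * A + 0.05 * y ^ 2) := by
        have : 0 ≤ A * |y| := by positivity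
        linarith

end Expansion

theorem chiStar_mem_Icc (A : Set ℝ) (t : ℝ) : chiStar A t ∈ Set.Icc (0 : ℝ) 1 := by
  unfold chiStar
  by_cases hint : t ∈ interior A
  · have hfrontier : t ∉ frontier A := fun h => h.2 hint
    simp [hint, hfrontier]
  · by_cases hfrontier : t ∈ frontier A <;> norm_num [hint, hfrontier]

theorem chiStar_Iic_of_lt {x t : ℝ} (h : t < x) : chiStar (Set.Iic x) t = 1 := by
  simp [chiStar, h, h.ne]

theorem chiStar_Iic_self (x : ℝ) : chiStar (Set.Iic x) x = 1 / 2 := by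
  simp [chiStar]

theorem chiStar_Iic_of_gt {x t : ℝ} (h : x < t) : chiStar (Set.Iic x) t = 0 := by
  simp [chiStar, h.le, h.ne']

theorem integral_Iic_add_Ici {g : ℝ → ℝ} (hg : Integrable g) (u : ℝ) :
    (∫ y in Set.Iic u, g y) + ∫ y in Set.Ici u, g y = ∫ y, g y := by
  rw [integral_Ici_eq_integral_Ioi]
  exact intervalIntegral.integral_Iic_add_Ioi hg.integrableOn hg.integrableOn

theorem integral_sub_mul {μ : Measure ℝ} {g₁ g₂ η : ℝ → ℝ}
    (h₁ : Integrable (fun y => g₁ y * η y) μ) (h₂ : Integrable (fun y => g₂ y * η y) μ) :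
    ∫ y, (g₁ y - g₂ y) * η y ∂μ = (∫ y, g₁ y * η y ∂μ) - ∫ y, g₂ y * η y ∂μ := by
  simp only [sub_mul]
  exact integral_sub h₁ h₂

/-- A nonnegative even kernel of mass one, supported in `[-ε, ε]`, whose second moment is at most
that of the uniform distribution. -/
structure IsKernel (η : ℝ → ℝ) (ε : ℝ) : Prop where
  integrable : Integrable η
  nonneg : ∀ y, 0 ≤ η y
  even : ∀ y, η (-y) = η y
  supp : ∀ y, ε < |y| → η y = 0
  mass : ∫ y, η y = 1
  second : ∫ y, y ^ 2 * η y ≤ ε ^ 2 / 3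

namespace IsKernel

variable {η : ℝ → ℝ} {ε : ℝ}

theorem integrable_of_continuousOn (hk : IsKernel η ε) {g : ℝ → ℝ} (hg : Measurable g)
    (hg' : ContinuousOn g (Set.Icc (-ε) ε)) : Integrable fun y => g y * η y := by
  obtain ⟨C, hC⟩ := isCompact_Icc.exists_bound_of_continuousOn hg'
  refine Integrable.mono' (hk.integrable.const_mul C)
    (hg.aestronglyMeasurable.mul hk.integrable.aestronglyMeasurable) (.of_forall fun y => ?_)
  rw [norm_mul, Real.norm_of_nonneg (hk.nonneg y)]
  by_cases hy : |y| ≤ ε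
  · exact mul_le_mul_of_nonneg_right (hC y (abs_le.1 hy)) (hk.nonneg y)
  · rw [hk.supp y (not_le.1 hy), mul_zero, mul_zero]

theorem integrable_of_continuous (hk : IsKernel η ε) {g : ℝ → ℝ} (hg : Continuous g) :
    Integrable fun y => g y * η y :=
  hk.integrable_of_continuousOn hg.measurable hg.continuousOn

theorem integral_odd (hk : IsKernel η ε) {g : ℝ → ℝ} (hg : ∀ y, g (-y) = -g y) :
    ∫ y, g y * η y = 0 := by
  have h := integral_neg_eq_self (fun y => g y * η y) volume
  simp only [hg, hk.even, neg_mul, integral_neg] at h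
  linarith

theorem integral_cubic (hk : IsKernel η ε) (a b c d : ℝ) :
    ∫ y, (a + b * y + c * y ^ 2 + d * y ^ 3) * η y = a + c * ∫ y, y ^ 2 * η y := by
  have h0 := hk.integrable
  have h1 : Integrable fun y => y * η y := hk.integrable_of_continuous (by fun_prop)
  have h2 : Integrable fun y => y ^ 2 * η y := hk.integrable_of_continuous (by fun_prop)
  have h3 : Integrable fun y => y ^ 3 * η y := hk.integrable_of_continuous (by fun_prop)
  simp only [add_mul, mul_assoc]
  rw [integral_add (by fun_prop) (by fun_prop), integral_add (by fun_prop) (by fun_prop),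
    integral_add (by fun_prop) (by fun_prop), integral_const_mul, integral_const_mul,
    integral_const_mul, integral_const_mul, hk.mass,
    hk.integral_odd (g := fun y => y) fun y => rfl,
    hk.integral_odd (g := fun y => y ^ 3) fun y => by ring]
  ring

theorem abs_setIntegral_le (hk : IsKernel η ε) {g : ℝ → ℝ} {a b : ℝ} (ha : 0 ≤ a) (hb : 0 ≤ b)
    (hg : ∀ y, |y| ≤ ε → |g y| ≤ a + b * y ^ 2) (s : Set ℝ) :
    |∫ y in s, g y * η y| ≤ a + b * ∫ y, y ^ 2 * η y := by
  have hint : Integrable fun y => (a + b * y ^ 2) * η y :=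
    hk.integrable_of_continuous (by fun_prop)
  have hpoint : ∀ y, ‖g y * η y‖ ≤ (a + b * y ^ 2) * η y := fun y => by
    rw [norm_mul, Real.norm_of_nonneg (hk.nonneg y)]
    by_cases hy : |y| ≤ ε
    · exact mul_le_mul_of_nonneg_right (hg y hy) (hk.nonneg y)
    · rw [hk.supp y (not_le.1 hy), mul_zero, mul_zero]
  calc |∫ y in s, g y * η y| ≤ ∫ y in s, (a + b * y ^ 2) * η y :=
        norm_integral_le_of_norm_le hint.integrableOn (.of_forall hpoint)
    _ ≤ ∫ y, (a + b * y ^ 2) * η y :=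
        setIntegral_le_integral hint
          (.of_forall fun y => mul_nonneg (by positivity) (hk.nonneg y))
    _ = a + b * ∫ y, y ^ 2 * η y := by simpa using hk.integral_cubic a 0 b 0

theorem abs_integral_le (hk : IsKernel η ε) {g : ℝ → ℝ} {b : ℝ} (hb : 0 ≤ b)
    (hg : ∀ y, |y| ≤ ε → |g y| ≤ b * y ^ 2) :
    |∫ y, g y * η y| ≤ b * ∫ y, y ^ 2 * η y := by
  simpa using hk.abs_setIntegral_le le_rfl hb (by simpa using hg) Set.univ

theorem integral_second_nonneg (hk : IsKernel η ε) : 0 ≤ ∫ y, y ^ 2 * η y :=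
  integral_nonneg fun y => mul_nonneg (sq_nonneg y) (hk.nonneg y)

theorem abs_integral_exp_sub_le (hk : IsKernel η ε) (hε : ε ≤ 1 / 10 ^ 3) :
    |(∫ y, Real.exp (-y / 2) * η y) - 1 - (∫ y, y ^ 2 * η y) / 8| ≤
      ε ^ 2 / 200 * ∫ y, y ^ 2 * η y := by
  have heq : (∫ y, Real.exp (-y / 2) * η y) - 1 - (∫ y, y ^ 2 * η y) / 8 =
      ∫ y, (Real.exp (-y / 2) - (1 + -1 / 2 * y + 1 / 8 * y ^ 2 + -1 / 48 * y ^ 3)) * η y := by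
    rw [integral_sub_mul (hk.integrable_of_continuous (by fun_prop))
      (hk.integrable_of_continuous (by fun_prop)), hk.integral_cubic]
    ring
  rw [heq]
  refine hk.abs_integral_le (by positivity) fun y hy => ?_
  have hexp := abs_exp_sub_cubic_le (abs_neg_half_le (hy.trans hε))
  have hsq : y ^ 2 ≤ ε ^ 2 := sq_le_sq' (abs_le.1 hy).1 (abs_le.1 hy).2
  calc _ = |Real.exp (-y / 2) - (1 + -y / 2 + (-y / 2) ^ 2 / 2 + (-y / 2) ^ 3 / 6)| := by ring_nf
    _ ≤ 5 / 96 * (-y / 2) ^ 4 := hexp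
    _ = 5 / 1536 * (y ^ 2 * y ^ 2) := by ring
    _ ≤ 1 / 200 * (ε ^ 2 * y ^ 2) := by
        gcongr ?_ * (?_ * _)
        norm_num
    _ = ε ^ 2 / 200 * y ^ 2 := by ring

theorem one_le_integral_exp (hk : IsKernel η ε) : 1 ≤ ∫ y, Real.exp (-y / 2) * η y := by
  calc (1 : ℝ) = ∫ y, (1 + -1 / 2 * y + 0 * y ^ 2 + 0 * y ^ 3) * η y := by
        rw [hk.integral_cubic]
        ring
    _ ≤ ∫ y, Real.exp (-y / 2) * η y := by
        refine integral_mono (hk.integrable_of_continuous (by fun_prop))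
          (hk.integrable_of_continuous (by fun_prop)) fun y => ?_
        exact mul_le_mul_of_nonneg_right (by linarith [Real.add_one_le_exp (-y / 2)]) (hk.nonneg y)

theorem integrable_transferKernel (hk : IsKernel η ε) (hε : ε ≤ 1 / 10 ^ 3) {s : ℝ} (hs : 0 ≤ s)
    (hs' : s ≤ 1.45) (A : ℝ) : Integrable fun y => transferKernel s A y * η y :=
  hk.integrable_of_continuousOn (measurable_transferKernel s A)
    (continuousOn_transferKernel A hs hs' hε)

-- The term of order `y ^ 2` in the expansion of `f₁` is cancelled by the mean of the `A`-term;
-- this is what the correction `A (f₂ - 2 f₃)` is for.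
theorem abs_integral_transferKernel_sub_le (hk : IsKernel η ε) (hε : ε ≤ 1 / 10 ^ 3) {s A : ℝ}
    (hs : 0 ≤ s) (hs' : s ≤ 1.45) (hA : ∫ y, y ^ 2 * η y = 2 * A) :
    |(∫ y, transferKernel s A y * η y) - ∫ y, Real.exp (-y / 2) * η y| ≤ 16 * ε ^ 2 * A * s := by
  have hA0 : 0 ≤ A := by linarith [hk.integral_second_nonneg]
  have hK := hk.integrable_transferKernel hε hs hs' A
  have hE : Integrable fun y => Real.exp (-y / 2) * η y :=
    hk.integrable_of_continuous (by fun_prop)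
  have heq : (∫ y, transferKernel s A y * η y) - ∫ y, Real.exp (-y / 2) * η y =
      ∫ y, (transferKernel s A y - Real.exp (-y / 2) - (A * s * (1 - 2 * s) +
        (s + A * s * (-1 / 2 + 3 * s - 6 * s ^ 2)) * y + s * (s - 1 / 2) * y ^ 2 +
        s * (s ^ 2 - s / 2 + 1 / 8) * y ^ 3)) * η y := by
    rw [integral_sub_mul ((hK.sub hE).congr (.of_forall fun y => (sub_mul _ _ _).symm))
      (hk.integrable_of_continuous (by fun_prop)), integral_sub_mul hK hE, hk.integral_cubic, hA]
    ring
  rw [heq]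
  calc _ ≤ (s * (2.25 * ε ^ 2) + A * s * 32) * ∫ y, y ^ 2 * η y := by
        refine hk.abs_integral_le (by positivity) fun y hy => ?_
        calc _ ≤ s * (2.25 * y ^ 4) + A * s * (32 * y ^ 2) :=
              abs_transferKernel_sub_exp_le hA0 hs hs' (hy.trans hε)
          _ = (s * (2.25 * y ^ 2) + A * s * 32) * y ^ 2 := by ring
          _ ≤ (s * (2.25 * ε ^ 2) + A * s * 32) * y ^ 2 := by
              have : y ^ 2 ≤ ε ^ 2 := sq_le_sq' (abs_le.1 hy).1 (abs_le.1 hy).2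
              gcongr
    _ = 4.5 * ε ^ 2 * A * s + 32 * A * s * (2 * A) := by rw [hA]; ring
    _ ≤ 4.5 * ε ^ 2 * A * s + 32 * A * s * (ε ^ 2 / 3) := by
        gcongr
        exact hA ▸ hk.second
    _ ≤ 16 * ε ^ 2 * A * s := by
        have : 0 ≤ s * A * ε ^ 2 := by positivity
        linarith

theorem integral_quadPart (hk : IsKernel η ε) {A : ℝ} (hA : ∫ y, y ^ 2 * η y = 2 * A) (s : ℝ) :
    ∫ y, quadPart s A y * η y = A / 4 := by
  have h := hk.integral_cubic (A * s * (1 - 2 * s)) 0 (s ^ 2 - s / 2 + 1 / 8) 0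
  simp only [zero_mul, add_zero, hA] at h
  simp only [quadPart, add_comm, h]
  ring

theorem abs_integral_Ici_transferKernel_sub_le (hk : IsKernel η ε) (hε₀ : 0 ≤ ε)
    (hε : ε ≤ 1 / 10 ^ 3) {s A : ℝ} (hs : 0 ≤ s) (hs' : s ≤ 0.11)
    (hA : ∫ y, y ^ 2 * η y = 2 * A) (u : ℝ) :
    |(∫ y in Set.Ici u, transferKernel s A y * η y) - ((∫ y in Set.Ici u, η y) +
      (s - 1 / 2) * (∫ y in Set.Ici u, y * η y) + ∫ y in Set.Ici u, quadPart s A y * η y)| ≤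
      A / 2000 := by
  have hA0 : 0 ≤ A := by linarith [hk.integral_second_nonneg]
  have hs2 : s ≤ 1.45 := hs'.trans (by norm_num)
  have h0 := hk.integrable.restrict (s := Set.Ici u)
  have h1 : IntegrableOn (fun y => y * η y) (Set.Ici u) :=
    (hk.integrable_of_continuous continuous_id).integrableOn
  have hlinear : IntegrableOn (fun y => η y + (s - 1 / 2) * (y * η y)) (Set.Ici u) :=
    h0.add (h1.const_mul _)
  have hQ := (hk.integrable_of_continuous (continuous_quadPart s A)).restrict (s := Set.Ici u)
  have hcont := continuous_quadPart s A
  have heq : (∫ y in Set.Ici u, transferKernel s A y * η y) - ((∫ y in Set.Ici u, η y) +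
      (s - 1 / 2) * (∫ y in Set.Ici u, y * η y) + ∫ y in Set.Ici u, quadPart s A y * η y) =
      ∫ y in Set.Ici u, (transferKernel s A y - (1 + (s - 1 / 2) * y + quadPart s A y)) * η y := by
    rw [integral_sub_mul (hk.integrable_transferKernel hε hs hs2 A).integrableOn
      (hk.integrable_of_continuous (by fun_prop)).integrableOn]
    simp only [add_mul, one_mul, mul_assoc]
    rw [integral_add hlinear hQ, integral_add h0 (h1.const_mul _), integral_const_mul]
  rw [heq]
  calc _ ≤ ε * (0.06 * A) + ε * 0.05 * ∫ y, y ^ 2 * η y := by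
        refine hk.abs_setIntegral_le (by positivity) (by positivity) (fun y hy => ?_) _
        calc _ ≤ |y| * (0.06 * A + 0.05 * y ^ 2) :=
              abs_transferKernel_sub_quadPart_le hA0 hs hs' (hy.trans hε)
          _ ≤ ε * (0.06 * A + 0.05 * y ^ 2) := by gcongr
          _ = ε * (0.06 * A) + ε * 0.05 * y ^ 2 := by ring
    _ = 0.16 * A * ε := by rw [hA]; ring
    _ ≤ 0.16 * A * (1 / 10 ^ 3) := by gcongr
    _ ≤ A / 2000 := by linarith

theorem integral_comp_neg_Ici (hk : IsKernel η ε) (g : ℝ → ℝ) (u : ℝ) :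
    ∫ y in Set.Ici u, g y * η y = ∫ y in Set.Iic (-u), g (-y) * η y := by
  rw [integral_Ici_eq_integral_Ioi, ← neg_neg u, ← integral_comp_neg_Iic, neg_neg]
  simp only [hk.even]

theorem integral_Ici_zero_of_even (hk : IsKernel η ε) {g : ℝ → ℝ} (hg : ∀ y, g (-y) = g y)
    (hi : Integrable fun y => g y * η y) :
    ∫ y in Set.Ici 0, g y * η y = (∫ y, g y * η y) / 2 := by
  have h := hk.integral_comp_neg_Ici g 0
  simp only [hg, neg_zero] at h
  linarith [integral_Iic_add_Ici hi 0]

theorem integral_Ici_le_half (hk : IsKernel η ε) {g : ℝ → ℝ} (hg : ∀ y, 0 ≤ g y)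
    (hg' : ∀ y, g (-y) = g y) (hi : Integrable fun y => g y * η y) {u : ℝ} (hu : 0 ≤ u) :
    ∫ y in Set.Ici u, g y * η y ≤ (∫ y, g y * η y) / 2 := by
  rw [← hk.integral_Ici_zero_of_even hg' hi]
  exact setIntegral_mono_set hi.integrableOn
    (.of_forall fun y => mul_nonneg (hg y) (hk.nonneg y)) (Set.Ici_subset_Ici.2 hu).eventuallyLE

theorem abs_integral_Ici_sub_chiStar_le (hk : IsKernel η ε) {g : ℝ → ℝ} (hg : ∀ y, 0 ≤ g y)
    (hg' : ∀ y, g (-y) = g y) (hi : Integrable fun y => g y * η y) (u : ℝ) :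
    |(∫ y in Set.Ici u, g y * η y) - chiStar (Set.Iic 0) u * ∫ y, g y * η y| ≤
      (∫ y, g y * η y) / 2 := by
  have hnonneg : ∀ v, 0 ≤ ∫ y in Set.Ici v, g y * η y := fun v =>
    setIntegral_nonneg measurableSet_Ici fun y _ => mul_nonneg (hg y) (hk.nonneg y)
  rcases lt_trichotomy u 0 with h | rfl | h
  · have hle := hk.integral_Ici_le_half hg hg' hi (neg_pos.2 h).le
    have hsymm := hk.integral_comp_neg_Ici g (-u)
    simp only [hg', neg_neg] at hsymm
    have hsum := integral_Iic_add_Ici hi u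
    rw [chiStar_Iic_of_lt h, abs_le]
    constructor <;> linarith [hnonneg (-u)]
  · have hhalf := hk.integral_Ici_zero_of_even hg' hi
    have htotal : 0 ≤ ∫ y, g y * η y := integral_nonneg fun y => mul_nonneg (hg y) (hk.nonneg y)
    rw [chiStar_Iic_self, abs_le]
    constructor <;> linarith
  · have hle := hk.integral_Ici_le_half hg hg' hi h.le
    rw [chiStar_Iic_of_gt h, zero_mul, sub_zero, abs_of_nonneg (hnonneg u)]
    exact hle

theorem integral_Iic_eq_zero (hk : IsKernel η ε) {τ : ℝ} (hτ : τ < -ε) :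
    ∫ y in Set.Iic τ, η y = 0 :=
  setIntegral_eq_zero_of_forall_eq_zero fun y hy =>
    hk.supp y (lt_abs.2 (Or.inr (by linarith [Set.mem_Iic.1 hy])))

theorem monotone_integral_Iic (hk : IsKernel η ε) : Monotone fun τ => ∫ y in Set.Iic τ, η y :=
  fun _ _ h => setIntegral_mono_set hk.integrable.integrableOn
    (.of_forall hk.nonneg) (Set.Iic_subset_Iic.2 h).eventuallyLE

theorem integral_Iic_nonneg (hk : IsKernel η ε) (τ : ℝ) : 0 ≤ ∫ y in Set.Iic τ, η y :=
  integral_nonneg hk.nonneg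

theorem integral_Iic_le_one (hk : IsKernel η ε) (τ : ℝ) : ∫ y in Set.Iic τ, η y ≤ 1 :=
  (setIntegral_le_integral hk.integrable (.of_forall hk.nonneg)).trans_eq hk.mass

end IsKernel

theorem setIntegral_Icc_indicator_Ici {a y : ℝ} (hay : a ≤ y) (u v : ℝ) :
    ∫ τ in Set.Icc a u, (Set.Ici y).indicator (fun _ => v) τ =
      (Set.Iic u).indicator (fun y => (u - y) * v) y := by
  have hset : Set.Ici y ∩ Set.Icc a u = Set.Icc y u := by
    ext τ
    exact ⟨fun h => ⟨h.1, h.2.2⟩, fun h => ⟨h.1, hay.trans h.1, h.2⟩⟩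
  rw [integral_indicator measurableSet_Ici, Measure.restrict_restrict measurableSet_Ici,
    setIntegral_const, hset, Real.volume_real_Icc, smul_eq_mul]
  by_cases hyu : y ≤ u
  · rw [Set.indicator_of_mem (Set.mem_Iic.2 hyu), max_eq_left (by linarith)]
  · rw [Set.indicator_of_notMem (mt Set.mem_Iic.1 hyu), max_eq_right (by linarith), zero_mul]

theorem IsKernel.integral_Iic_integral_Iic {η : ℝ → ℝ} {ε : ℝ} (hk : IsKernel η ε) (u : ℝ) :
    ∫ τ in Set.Iic u, ∫ y in Set.Iic τ, η y = ∫ y in Set.Iic u, (u - y) * η y := by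
  have hinner : ∀ τ, ∫ y in Set.Iic τ, η y = ∫ y, (Set.Ici y).indicator (fun _ => η y) τ :=
    fun τ => (integral_indicator measurableSet_Iic).symm
  have hint : Integrable (fun p : ℝ × ℝ => (Set.Ici p.2).indicator (fun _ => η p.2) p.1)
      ((volume.restrict (Set.Icc (-ε) u)).prod volume) :=
    (hk.integrable.comp_snd _).indicator (measurableSet_le measurable_snd measurable_fst)
  calc ∫ τ in Set.Iic u, ∫ y in Set.Iic τ, η y
      = ∫ τ in Set.Icc (-ε) u, ∫ y in Set.Iic τ, η y := by
        refine setIntegral_eq_of_subset_of_forall_sdiff_eq_zero measurableSet_Iic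
          Set.Icc_subset_Iic_self fun τ hτ => hk.integral_Iic_eq_zero ?_
        exact not_le.1 fun h => hτ.2 ⟨h, hτ.1⟩
    _ = ∫ y, ∫ τ in Set.Icc (-ε) u, (Set.Ici y).indicator (fun _ => η y) τ := by
        simp_rw [hinner]
        exact integral_integral_swap hint
    _ = ∫ y in Set.Iic u, (u - y) * η y := by
        rw [← integral_indicator measurableSet_Iic]
        refine integral_congr_ae (.of_forall fun y => ?_)
        by_cases hy : |y| ≤ ε
        · exact setIntegral_Icc_indicator_Ici (abs_le.1 hy).1 u (η y)
        · simp [Set.indicator_apply, hk.supp y (not_le.1 hy)]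

end LoganPi

namespace LoganPi

section MuNu

variable {c ε : ℝ}

theorem mu_of_neg {u : ℝ} (hu : u < 0) : mu c ε u = -∫ y in Set.Iic u, eta c ε y := by
  rw [mu, if_pos hu]

theorem mu_of_pos (hk : IsKernel (eta c ε) ε) {u : ℝ} (hu : 0 < u) :
    mu c ε u = ∫ y in Set.Ici u, eta c ε y := by
  have hreflect := hk.integral_comp_neg_Ici (fun _ => 1) u
  simp only [one_mul] at hreflect
  rw [mu, if_neg hu.not_gt, if_pos hu, hreflect]

theorem mu_zero : mu c ε 0 = 0 := by
  simp [mu]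

theorem mu_neg (u : ℝ) : mu c ε (-u) = -mu c ε u := by
  rcases lt_trichotomy u 0 with h | rfl | h
  · rw [mu, mu, if_pos h, if_neg (by linarith), if_pos (by linarith), neg_neg, neg_neg]
  · rw [neg_zero, mu_zero, neg_zero]
  · rw [mu, mu, if_pos (by linarith), if_neg (by linarith), if_pos h]

theorem measurable_mu (hk : IsKernel (eta c ε) ε) : Measurable (mu c ε) := by
  have h := hk.monotone_integral_Iic.measurable
  exact Measurable.ite measurableSet_Iio h.neg
    (Measurable.ite measurableSet_Ioi (h.comp measurable_neg) measurable_const)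

theorem abs_mu_le_one (hk : IsKernel (eta c ε) ε) (u : ℝ) : |mu c ε u| ≤ 1 := by
  unfold mu
  split_ifs
  · rw [abs_neg, abs_of_nonneg (hk.integral_Iic_nonneg u)]
    exact hk.integral_Iic_le_one u
  · rw [abs_of_nonneg (hk.integral_Iic_nonneg _)]
    exact hk.integral_Iic_le_one _
  · norm_num

theorem integrableOn_mu (hk : IsKernel (eta c ε) ε) (hε : 0 < ε) (u : ℝ) :
    IntegrableOn (mu c ε) (Set.Iic u) := by
  have hbounded : IntegrableOn (mu c ε) (Set.Icc (-ε) u) :=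
    Measure.integrableOn_of_bounded (M := 1) measure_Icc_lt_top.ne
      (measurable_mu hk).aestronglyMeasurable (.of_forall fun τ => abs_mu_le_one hk τ)
  have hzero : IntegrableOn (mu c ε) (Set.Iio (-ε)) := by
    refine integrableOn_zero.congr_fun (fun τ hτ => ?_) measurableSet_Iio
    have hτ' : τ < -ε := hτ
    rw [mu_of_neg (by linarith), hk.integral_Iic_eq_zero hτ', neg_zero]
  exact (hzero.union hbounded).mono_set fun τ hτ => (lt_or_ge τ (-ε)).imp id fun h => ⟨h, hτ⟩

theorem nu_neg (hk : IsKernel (eta c ε) ε) (hε : 0 < ε) (u : ℝ) : nu c ε (-u) = nu c ε u := by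
  have hsub := intervalIntegral.integral_Iic_sub_Iic (integrableOn_mu hk hε (-u))
    (integrableOn_mu hk hε u)
  have hodd := intervalIntegral.integral_comp_neg (a := -u) (b := u) (mu c ε)
  simp only [mu_neg, neg_neg, intervalIntegral.integral_neg] at hodd
  rw [nu, nu]
  linarith

theorem mu_mul_sub_nu_of_nonpos (hk : IsKernel (eta c ε) ε) {u : ℝ} (hu : u ≤ 0) :
    mu c ε u * u - nu c ε u = ∫ y in Set.Ici u, y * eta c ε y := by
  have hint : Integrable fun y => y * eta c ε y := hk.integrable_of_continuous continuous_id
  have hnu : nu c ε u = -∫ y in Set.Iic u, (u - y) * eta c ε y := by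
    rw [← hk.integral_Iic_integral_Iic, nu, ← integral_neg, integral_Iic_eq_integral_Iio,
      integral_Iic_eq_integral_Iio]
    exact setIntegral_congr_fun measurableSet_Iio fun τ hτ => mu_of_neg (lt_of_lt_of_le hτ hu)
  have hmu : mu c ε u * u = -(u * ∫ y in Set.Iic u, eta c ε y) := by
    rcases hu.lt_or_eq with h | rfl
    · rw [mu_of_neg h]
      ring
    · rw [mul_zero, zero_mul, neg_zero]
  have hsplit : ∫ y in Set.Iic u, (u - y) * eta c ε y =
      u * (∫ y in Set.Iic u, eta c ε y) - ∫ y in Set.Iic u, y * eta c ε y := by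
    rw [integral_sub_mul (hk.integrable.const_mul u).integrableOn hint.integrableOn,
      integral_const_mul]
  have hodd := hk.integral_odd (g := fun y => y) fun y => rfl
  rw [hnu, hmu, hsplit]
  linarith [integral_Iic_add_Ici hint u]

theorem mu_mul_sub_nu (hk : IsKernel (eta c ε) ε) (hε : 0 < ε) (u : ℝ) :
    mu c ε u * u - nu c ε u = ∫ y in Set.Ici u, y * eta c ε y := by
  rcases le_total u 0 with h | h
  · exact mu_mul_sub_nu_of_nonpos hk h
  · have hint : Integrable fun y => y * eta c ε y := hk.integrable_of_continuous continuous_id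
    have hreflect := mu_mul_sub_nu_of_nonpos hk (neg_nonpos.2 h)
    rw [mu_neg, nu_neg hk hε, neg_mul_neg] at hreflect
    have hcomp := hk.integral_comp_neg_Ici (fun y => y) (-u)
    simp only [neg_neg, neg_mul, integral_neg] at hcomp
    have hodd := hk.integral_odd (g := fun y => y) fun y => rfl
    linarith [integral_Iic_add_Ici hint u]

theorem integral_Ici_eta (hk : IsKernel (eta c ε) ε) (u : ℝ) :
    ∫ y in Set.Ici u, eta c ε y = chiStar (Set.Iic 0) u + mu c ε u := by
  rcases lt_trichotomy u 0 with h | rfl | h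
  · rw [chiStar_Iic_of_lt h, mu_of_neg h]
    linarith [integral_Iic_add_Ici hk.integrable u, hk.mass]
  · have hhalf := hk.integral_Ici_zero_of_even (g := fun _ => 1) (fun _ => rfl)
      (hk.integrable_of_continuous continuous_const)
    simp only [one_mul, hk.mass] at hhalf
    rw [chiStar_Iic_self, mu_zero, hhalf, add_zero]
  · rw [chiStar_Iic_of_gt h, mu_of_pos hk h, zero_add]

end MuNu

end LoganPi

namespace LoganPi

theorem hasSum_besselI0 (y : ℝ) :
    HasSum (fun n : ℕ => (y / 2) ^ (2 * n) / ((n.factorial : ℝ) ^ 2)) (besselI0 y) := by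
  refine (Summable.of_nonneg_of_le (fun n => ?_) (fun n => ?_)
    (Real.summable_pow_div_factorial ((y / 2) ^ 2))).hasSum
  · rw [pow_mul]
    positivity
  · have hfactorial : (1 : ℝ) ≤ n.factorial := by exact_mod_cast n.factorial_pos
    rw [pow_mul]
    gcongr
    exact le_self_pow₀ hfactorial two_ne_zero

theorem hasSum_besselI0_mul_sqrt (c : ℝ) {z : ℝ} (hz : 0 ≤ z) :
    HasSum (fun n : ℕ => (c ^ 2 / 4) ^ n / ((n.factorial : ℝ) ^ 2) * z ^ n)
      (besselI0 (c * √z)) := by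
  refine (hasSum_besselI0 (c * √z)).congr_fun fun n => ?_
  have hsq : (c * √z / 2) ^ 2 = c ^ 2 / 4 * z := by
    rw [div_pow, mul_pow, Real.sq_sqrt hz]
    ring
  rw [pow_mul, hsq, mul_pow, div_mul_eq_mul_div]

theorem besselI0_nonneg (y : ℝ) : 0 ≤ besselI0 y :=
  (hasSum_besselI0 y).nonneg fun n => by
    rw [pow_mul]
    positivity

theorem measurable_besselI0 : Measurable besselI0 := by
  refine measurable_of_tendsto_metrizable (f := fun N y => ∑ n ∈ Finset.range N,
    (y / 2) ^ (2 * n) / ((n.factorial : ℝ) ^ 2)) (fun N => by fun_prop) ?_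
  exact tendsto_pi_nhds.2 fun y => (hasSum_besselI0 y).tendsto_sum_nat

theorem besselI0_le {y z : ℝ} (h : |y| ≤ |z|) : besselI0 y ≤ besselI0 z := by
  refine hasSum_le (fun n => ?_) (hasSum_besselI0 y) (hasSum_besselI0 z)
  have hsq : (y / 2) ^ 2 ≤ (z / 2) ^ 2 := by
    rw [div_pow, div_pow]
    gcongr ?_ / _
    exact sq_le_sq.2 h
  rw [pow_mul, pow_mul]
  gcongr

theorem chiStar_Icc_of_mem {y : ℝ} (hy : y ∈ Set.Ioo (-1 : ℝ) 1) :
    chiStar (Set.Icc (-1) 1) y = 1 := by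
  have hbdry : y ∉ ({-1, 1} : Set ℝ) := by
    rintro (rfl | rfl) <;> norm_num at hy
  simp [chiStar, frontier_Icc (show (-1 : ℝ) ≤ 1 by norm_num), hy, hbdry]

theorem chiStar_Icc_of_lt_abs {y : ℝ} (hy : 1 < |y|) : chiStar (Set.Icc (-1) 1) y = 0 := by
  have hint : y ∉ Set.Ioo (-1 : ℝ) 1 := fun h => hy.not_gt (abs_lt.2 h)
  have hbdry : y ∉ ({-1, 1} : Set ℝ) := by
    rintro (rfl | rfl) <;> norm_num at hy
  rw [chiStar, interior_Icc, frontier_Icc (by norm_num), Set.indicator_of_notMem hint,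
    Set.indicator_of_notMem hbdry, add_zero]

theorem chiStar_Icc_neg (y : ℝ) :
    chiStar (Set.Icc (-1) 1) (-y) = chiStar (Set.Icc (-1) 1) y := by
  have hint : -y ∈ Set.Ioo (-1 : ℝ) 1 ↔ y ∈ Set.Ioo (-1 : ℝ) 1 := by
    rw [Set.mem_Ioo, Set.mem_Ioo, neg_lt_neg_iff, neg_lt, and_comm]
  have hbdry : -y ∈ ({-1, 1} : Set ℝ) ↔ y ∈ ({-1, 1} : Set ℝ) := by
    rw [Set.mem_insert_iff, Set.mem_singleton_iff, neg_inj, neg_eq_iff_eq_neg, or_comm]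
    rfl
  simp only [chiStar, interior_Icc, frontier_Icc (show (-1 : ℝ) ≤ 1 by norm_num), Set.indicator,
    hint, hbdry]

theorem measurable_chiStar (A : Set ℝ) : Measurable (chiStar A) :=
  (measurable_const.indicator isOpen_interior.measurableSet).add
    (measurable_const.indicator isClosed_frontier.measurableSet)

theorem measurable_eta1 (c : ℝ) : Measurable (eta1 c) := by
  have := measurable_chiStar (Set.Icc (-1) 1)
  have := measurable_besselI0
  unfold eta1
  fun_prop

theorem eta1_neg (c y : ℝ) : eta1 c (-y) = eta1 c y := by
  simp only [eta1, chiStar_Icc_neg, neg_sq]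

theorem eta1_of_lt_abs (c : ℝ) {y : ℝ} (hy : 1 < |y|) : eta1 c y = 0 := by
  rw [eta1, chiStar_Icc_of_lt_abs hy, zero_mul, zero_mul]

theorem eta1_of_notMem_Icc (c : ℝ) {y : ℝ} (hy : y ∉ Set.Icc (-1 : ℝ) 1) : eta1 c y = 0 :=
  eta1_of_lt_abs c (not_le.1 fun h => hy (abs_le.1 h))

theorem eta1_nonneg {c : ℝ} (hc : 0 < c) (y : ℝ) : 0 ≤ eta1 c y := by
  have := Real.sinh_pos_iff.2 hc
  exact mul_nonneg (mul_nonneg (chiStar_mem_Icc _ y).1 (by positivity)) (besselI0_nonneg _)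

theorem eta1_le {c : ℝ} (hc : 0 < c) (y : ℝ) :
    eta1 c y ≤ c / (2 * Real.sinh c) * besselI0 c := by
  have := Real.sinh_pos_iff.2 hc
  have hnonneg := besselI0_nonneg (c * √(1 - y ^ 2))
  have hbessel : besselI0 (c * √(1 - y ^ 2)) ≤ besselI0 c := by
    refine besselI0_le ?_
    rw [abs_mul, abs_of_nonneg (Real.sqrt_nonneg _)]
    exact mul_le_of_le_one_right (abs_nonneg _) (Real.sqrt_le_one.2 (by nlinarith [sq_nonneg y]))
  unfold eta1
  gcongr
  exact mul_le_of_le_one_left (by positivity) (chiStar_mem_Icc _ y).2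

theorem integrable_eta1 {c : ℝ} (hc : 0 < c) : Integrable (eta1 c) := by
  have hbounded : IntegrableOn (eta1 c) (Set.Icc (-1) 1) :=
    Measure.integrableOn_of_bounded measure_Icc_lt_top.ne (measurable_eta1 c).aestronglyMeasurable
      (.of_forall fun y => (Real.norm_of_nonneg (eta1_nonneg hc y)).trans_le (eta1_le hc y))
  exact (integrableOn_iff_integrable_of_support_subset fun y hy =>
    not_imp_comm.1 (eta1_of_notMem_Icc c) hy).1 hbounded

/-- The integral of `(1 - y ^ 2) ^ n` over `[-1, 1]`, which gives the moments of the powers of `y`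
against the terms of the series of `eta1`. -/
noncomputable def wallis (n : ℕ) : ℝ := ∫ y in (-1 : ℝ)..1, (1 - y ^ 2) ^ n

theorem wallis_succ (n : ℕ) : wallis (n + 1) * (2 * n + 3) = (2 * n + 2) * wallis n := by
  have hderiv : ∀ y ∈ Set.uIcc (-1 : ℝ) 1, HasDerivAt (fun y : ℝ => y * (1 - y ^ 2) ^ (n + 1))
      ((2 * n + 3) * (1 - y ^ 2) ^ (n + 1) - (2 * n + 2) * (1 - y ^ 2) ^ n) y := fun y _ => by
    have hbase : HasDerivAt (fun y : ℝ => 1 - y ^ 2) (-(2 * y)) y := by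
      simpa using (hasDerivAt_pow 2 y).const_sub 1
    refine ((hasDerivAt_id y).mul (hbase.pow (n + 1))).congr_deriv ?_
    simp only [id, Nat.add_sub_cancel, Pi.pow_apply]
    push_cast
    ring
  have h := intervalIntegral.integral_eq_sub_of_hasDerivAt hderiv
    (Continuous.intervalIntegrable (by fun_prop) _ _)
  rw [intervalIntegral.integral_sub (Continuous.intervalIntegrable (by fun_prop) _ _)
    (Continuous.intervalIntegrable (by fun_prop) _ _), intervalIntegral.integral_const_mul,
    intervalIntegral.integral_const_mul] at h
  norm_num at h
  rw [wallis, wallis]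
  linarith

theorem integral_sq_mul_one_sub_sq_pow (n : ℕ) :
    ∫ y in (-1 : ℝ)..1, y ^ 2 * (1 - y ^ 2) ^ n = wallis n / (2 * n + 3) := by
  have hsub : ∫ y in (-1 : ℝ)..1, y ^ 2 * (1 - y ^ 2) ^ n = wallis n - wallis (n + 1) := by
    rw [wallis, wallis, ← intervalIntegral.integral_sub
      (Continuous.intervalIntegrable (by fun_prop) _ _)
      (Continuous.intervalIntegrable (by fun_prop) _ _)]
    congr with y
    ring
  rw [hsub, eq_div_iff (by positivity)]
  linarith [wallis_succ n]

theorem coeff_mul_wallis (c : ℝ) (n : ℕ) :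
    (c ^ 2 / 4) ^ n / ((n.factorial : ℝ) ^ 2) * wallis n =
      2 * (c ^ (2 * n) / ((2 * n + 1).factorial : ℝ)) := by
  induction n with
  | zero => norm_num [wallis]
  | succ n ih =>
    have hwallis : wallis (n + 1) = (2 * n + 2) * wallis n / (2 * n + 3) := by
      rw [eq_div_iff (by positivity), wallis_succ]
    have hfactorial : (2 * (n + 1) + 1).factorial =
        (2 * n + 3) * ((2 * n + 2) * (2 * n + 1).factorial) := rfl
    calc _ = ((c ^ 2 / 4) ^ n / ((n.factorial : ℝ) ^ 2) * wallis n) *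
          (c ^ 2 / ((2 * n + 2) * (2 * n + 3))) := by
          rw [hwallis, Nat.factorial_succ]
          push_cast
          field_simp
          ring
      _ = 2 * (c ^ (2 * (n + 1)) / ((2 * (n + 1) + 1).factorial : ℝ)) := by
          rw [ih, hfactorial]
          push_cast
          field_simp
          ring

theorem integral_mul_eta1 (c : ℝ) (g : ℝ → ℝ) :
    ∫ y, g y * eta1 c y =
      c / (2 * Real.sinh c) * ∫ y in (-1 : ℝ)..1, g y * besselI0 (c * √(1 - y ^ 2)) := by
  have hsupp : ∫ y, g y * eta1 c y = ∫ y in Set.Icc (-1) 1, g y * eta1 c y :=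
    (setIntegral_eq_integral_of_forall_compl_eq_zero fun y hy => by
      rw [eta1_of_notMem_Icc c hy, mul_zero]).symm
  rw [hsupp, intervalIntegral.integral_of_le (by norm_num), integral_Icc_eq_integral_Ioo,
    integral_Ioc_eq_integral_Ioo, ← integral_const_mul]
  refine setIntegral_congr_fun measurableSet_Ioo fun y hy => ?_
  simp only [eta1, chiStar_Icc_of_mem hy]
  ring

theorem hasSum_integral_mul_eta1 (c : ℝ) {g : ℝ → ℝ} (hg : Continuous g) :
    HasSum (fun n : ℕ => c / (2 * Real.sinh c) * ((c ^ 2 / 4) ^ n / ((n.factorial : ℝ) ^ 2) *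
      ∫ y in (-1 : ℝ)..1, g y * (1 - y ^ 2) ^ n)) (∫ y, g y * eta1 c y) := by
  obtain ⟨C, hC⟩ :=
    (isCompact_Icc (a := (-1 : ℝ)) (b := 1)).exists_bound_of_continuousOn hg.continuousOn
  have hmem : ∀ {y}, y ∈ Set.uIoc (-1 : ℝ) 1 → y ∈ Set.Icc (-1 : ℝ) 1 := fun hy =>
    Set.Ioc_subset_Icc_self (by rwa [Set.uIoc_of_le (by norm_num)] at hy)
  have hbase : ∀ {y}, y ∈ Set.Icc (-1 : ℝ) 1 → 0 ≤ 1 - y ^ 2 := fun hy => by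
    nlinarith [hy.1, hy.2]
  have hcoeff := (hasSum_besselI0_mul_sqrt c zero_le_one).summable
  simp only [one_pow, mul_one] at hcoeff
  have hseries : HasSum (fun n : ℕ => ∫ y in (-1 : ℝ)..1,
      (c ^ 2 / 4) ^ n / ((n.factorial : ℝ) ^ 2) * (g y * (1 - y ^ 2) ^ n))
      (∫ y in (-1 : ℝ)..1, g y * besselI0 (c * √(1 - y ^ 2))) := by
    refine intervalIntegral.hasSum_integral_of_dominated_convergence
      (fun n _ => (c ^ 2 / 4) ^ n / ((n.factorial : ℝ) ^ 2) * C)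
      (fun n => Continuous.aestronglyMeasurable (by fun_prop)) (fun n => .of_forall fun y hy => ?_)
      (.of_forall fun _ _ => hcoeff.mul_right C) intervalIntegrable_const
      (.of_forall fun y hy => ?_)
    · have hnonneg := hbase (hmem hy)
      rw [norm_mul, norm_mul, Real.norm_of_nonneg (by positivity), norm_pow,
        Real.norm_of_nonneg hnonneg]
      gcongr
      exact (mul_le_of_le_one_right (norm_nonneg _)
        (pow_le_one₀ hnonneg (by nlinarith [sq_nonneg y]))).trans (hC y (hmem hy))
    · refine ((hasSum_besselI0_mul_sqrt c (hbase (hmem hy))).mul_left (g y)).congr_fun fun n => ?_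
      ring
  rw [integral_mul_eta1]
  simpa only [intervalIntegral.integral_const_mul] using hseries.mul_left (c / (2 * Real.sinh c))

theorem integral_eta1 {c : ℝ} (hc : 0 < c) : ∫ y, eta1 c y = 1 := by
  have hsinh := Real.sinh_pos_iff.2 hc
  have h := hasSum_integral_mul_eta1 c (g := fun _ => 1) continuous_const
  simp only [one_mul, ← wallis.eq_def, coeff_mul_wallis] at h
  have hone := (Real.hasSum_sinh c).mul_left (Real.sinh c)⁻¹
  rw [inv_mul_cancel₀ hsinh.ne'] at hone
  refine h.unique (hone.congr_fun fun n => ?_)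
  rw [pow_succ]
  field_simp

theorem hasSum_integral_sq_mul_eta1 (c : ℝ) :
    HasSum (fun n : ℕ => c / Real.sinh c *
      (c ^ (2 * n) / ((2 * n + 1).factorial : ℝ) / (2 * n + 3))) (∫ y, y ^ 2 * eta1 c y) := by
  have h := hasSum_integral_mul_eta1 c (g := fun y => y ^ 2) (by fun_prop)
  simp only [integral_sq_mul_one_sub_sq_pow, ← mul_div_assoc, coeff_mul_wallis] at h
  refine h.congr_fun fun n => ?_
  ring

theorem integral_sq_mul_eta1_le_third {c : ℝ} (hc : 0 < c) :
    ∫ y, y ^ 2 * eta1 c y ≤ 1 / 3 := by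
  have hsinh := Real.sinh_pos_iff.2 hc
  have hthird := (Real.hasSum_sinh c).mul_left ((Real.sinh c)⁻¹ / 3)
  rw [div_mul_eq_mul_div, inv_mul_cancel₀ hsinh.ne'] at hthird
  refine hasSum_le (fun n => ?_) (hasSum_integral_sq_mul_eta1 c) hthird
  calc c / Real.sinh c * (c ^ (2 * n) / ((2 * n + 1).factorial : ℝ) / (2 * n + 3))
      ≤ c / Real.sinh c * (c ^ (2 * n) / ((2 * n + 1).factorial : ℝ) / 3) := by
        gcongr
        linarith [n.cast_nonneg (α := ℝ)]
    _ = (Real.sinh c)⁻¹ / 3 * (c ^ (2 * n + 1) / ((2 * n + 1).factorial : ℝ)) := by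
        rw [pow_succ]
        field_simp

theorem hasSum_mul_cosh_sub_sinh (c : ℝ) :
    HasSum (fun n : ℕ => c ^ 3 * (c ^ (2 * n) / ((2 * n + 1).factorial : ℝ) / (2 * n + 3)))
      (c * Real.cosh c - Real.sinh c) := by
  have h := (hasSum_nat_add_iff' 1).2
    (((Real.hasSum_cosh c).mul_left c).sub (Real.hasSum_sinh c))
  simp only [Finset.range_one, Finset.sum_singleton, mul_zero, pow_zero, Nat.factorial_zero,
    Nat.cast_one, div_one, zero_add, pow_one, Nat.factorial_one, mul_one, sub_self, sub_zero] at h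
  refine h.congr_fun fun n => ?_
  have hodd : (2 * (n + 1) + 1).factorial = (2 * n + 3) * ((2 * n + 2) * (2 * n + 1).factorial) :=
    rfl
  have heven : (2 * (n + 1)).factorial = (2 * n + 2) * (2 * n + 1).factorial := rfl
  rw [hodd, heven]
  push_cast
  field_simp
  ring

theorem integral_sq_mul_eta1 {c : ℝ} (hc : c ≠ 0) :
    ∫ y, y ^ 2 * eta1 c y = (c * Real.cosh c - Real.sinh c) / (c ^ 2 * Real.sinh c) := by
  refine (hasSum_integral_sq_mul_eta1 c).unique
    (((hasSum_mul_cosh_sub_sinh c).div_const _).congr_fun fun n => ?_)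
  have hsinh := Real.sinh_ne_zero.2 hc
  field_simp

theorem integral_sq_mul_eta1_le_inv {c : ℝ} (hc : 0 < c) :
    ∫ y, y ^ 2 * eta1 c y ≤ 1 / c := by
  have := Real.sinh_pos_iff.2 hc
  have hself : c ≤ Real.sinh c := Real.self_le_sinh_iff.2 hc.le
  have hexp : Real.exp (-c) ≤ 1 := Real.exp_le_one_iff.2 (by linarith)
  have hnum : c * Real.cosh c - Real.sinh c ≤ c * Real.sinh c := by
    nlinarith [Real.cosh_sub_sinh c]
  rw [integral_sq_mul_eta1 hc.ne']
  calc _ ≤ c * Real.sinh c / (c ^ 2 * Real.sinh c) := by gcongr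
    _ = 1 / c := by field_simp

theorem integral_mul_eta {c ε : ℝ} (hε : 0 < ε) (g : ℝ → ℝ) :
    ∫ y, g y * eta c ε y = ∫ y, g (ε * y) * eta1 c y := by
  have h := Measure.integral_comp_div (fun y => ε⁻¹ * (g (ε * y) * eta1 c y)) ε
  rw [integral_const_mul ε⁻¹ (fun y => g (ε * y) * eta1 c y), smul_eq_mul, abs_of_pos hε,
    mul_inv_cancel_left₀ hε.ne'] at h
  rw [← h]
  congr with y
  rw [mul_div_cancel₀ _ hε.ne', eta]
  ring

theorem integral_sq_mul_eta {c ε : ℝ} (hε : 0 < ε) :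
    ∫ y, y ^ 2 * eta c ε y = ε ^ 2 * ∫ y, y ^ 2 * eta1 c y := by
  rw [integral_mul_eta hε fun y => y ^ 2, ← integral_const_mul]
  simp only [mul_pow, mul_assoc]

theorem isKernel_eta {c ε : ℝ} (hc : 0 < c) (hε : 0 < ε) : IsKernel (eta c ε) ε where
  integrable := ((integrable_eta1 hc).comp_div hε.ne').const_mul (1 / ε)
  nonneg y := mul_nonneg (by positivity) (eta1_nonneg hc _)
  even y := by simp only [eta, neg_div, eta1_neg]
  supp y hy := by
    rw [eta, eta1_of_lt_abs c, mul_zero]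
    rwa [abs_div, abs_of_pos hε, one_lt_div hε]
  mass := by simpa [integral_eta1 hc] using integral_mul_eta (c := c) hε fun _ => 1
  second := by
    rw [integral_sq_mul_eta hε, div_eq_mul_one_div]
    gcongr
    exact integral_sq_mul_eta1_le_third hc

theorem integral_sq_mul_eta_le {c ε : ℝ} (hc : 0 < c) (hε : 0 < ε) :
    ∫ y, y ^ 2 * eta c ε y ≤ ε ^ 2 / c := by
  rw [integral_sq_mul_eta hε, div_eq_mul_one_div]
  gcongr
  exact integral_sq_mul_eta1_le_inv hc

end LoganPi

namespace LoganPi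

/-- The measure on `ℝ` with density `η`, whose complex moment generating function is `fourierHat η`
up to a rotation of the argument. -/
noncomputable def densityMeasure (η : ℝ → ℝ) : Measure ℝ :=
  volume.withDensity fun y => ENNReal.ofReal (η y)

namespace IsKernel

variable {η : ℝ → ℝ} {ε : ℝ}

theorem integral_densityMeasure (hk : IsKernel η ε) (g : ℝ → ℂ) :
    ∫ y, g y ∂densityMeasure η = ∫ y, (η y : ℂ) * g y := by
  rw [densityMeasure, integral_withDensity_eq_integral_toReal_smul₀
    hk.integrable.aestronglyMeasurable.aemeasurable.ennreal_ofReal (by simp)]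
  simp only [ENNReal.toReal_ofReal (hk.nonneg _), Complex.real_smul]

theorem integrable_densityMeasure (hk : IsKernel η ε) {g : ℝ → ℝ} (hg : Continuous g) :
    Integrable g (densityMeasure η) := by
  rw [densityMeasure, integrable_withDensity_iff_integrable_smul₀'
    hk.integrable.aestronglyMeasurable.aemeasurable.ennreal_ofReal (by simp)]
  simpa only [ENNReal.toReal_ofReal (hk.nonneg _), smul_eq_mul, mul_comm] using
    hk.integrable_of_continuous hg

theorem fourierHat_eq_complexMGF (hk : IsKernel η ε) :
    fourierHat η = fun ξ => ProbabilityTheory.complexMGF id (densityMeasure η) (Complex.I * ξ) := by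
  funext ξ
  rw [fourierHat, ProbabilityTheory.complexMGF, hk.integral_densityMeasure]
  rfl

theorem iteratedDeriv_two_fourierHat_zero (hk : IsKernel η ε) :
    iteratedDeriv 2 (fourierHat η) 0 = ((-∫ y, y ^ 2 * η y : ℝ) : ℂ) := by
  have hset : ProbabilityTheory.integrableExpSet id (densityMeasure η) = Set.univ :=
    Set.eq_univ_of_forall fun t =>
      hk.integrable_densityMeasure (g := fun y => Real.exp (t * y)) (by fun_prop)
  have hmem (z : ℂ) :
      z.re ∈ interior (ProbabilityTheory.integrableExpSet id (densityMeasure η)) := by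
    simp [hset]
  have hdiff : Differentiable ℂ (ProbabilityTheory.complexMGF id (densityMeasure η)) := fun z =>
    (ProbabilityTheory.hasDerivAt_complexMGF (hmem z)).differentiableAt
  rw [hk.fourierHat_eq_complexMGF, iteratedDeriv_comp_const_mul hdiff.contDiff]
  simp only [mul_zero]
  rw [ProbabilityTheory.iteratedDeriv_complexMGF (hmem 0), hk.integral_densityMeasure,
    Complex.I_sq, Complex.ofReal_neg, ← integral_complex_ofReal, neg_one_mul]
  congr with y
  simp only [id, zero_mul, Complex.exp_zero, mul_one]
  push_cast
  ring

end IsKernel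

theorem lam_eq (c ε : ℝ) : lam c ε = ∫ y, Real.exp (-y / 2) * eta c ε y := by
  have hell : ell c ε (Complex.I / 2) = ((∫ y, Real.exp (-y / 2) * eta c ε y : ℝ) : ℂ) := by
    rw [ell, fourierHat, ← integral_complex_ofReal]
    congr with t
    have hexponent : Complex.I * (Complex.I / 2) * (t : ℂ) = ((-t / 2 : ℝ) : ℂ) := by
      push_cast
      linear_combination (t : ℂ) / 2 * Complex.I_mul_I
    rw [hexponent, ← Complex.ofReal_exp]
    push_cast
    ring
  rw [lam, hell, Complex.ofReal_re]

section Weights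

variable {c ε : ℝ}

theorem one_le_lam (hc : 0 < c) (hε : 0 < ε) : 1 ≤ lam c ε := by
  rw [lam_eq]
  exact (isKernel_eta hc hε).one_le_integral_exp

theorem integral_sq_eq_two_mul_coeffA (hc : 0 < c) (hε : 0 < ε) :
    ∫ y, y ^ 2 * eta c ε y = 2 * coeffA c ε := by
  have hell : ell c ε = fourierHat (eta c ε) := rfl
  rw [coeffA, hell, (isKernel_eta hc hε).iteratedDeriv_two_fourierHat_zero, ← Complex.ofReal_neg,
    neg_neg, ← Complex.ofReal_ofNat, ← Complex.ofReal_div, Complex.ofReal_re,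
    mul_div_cancel₀ _ two_ne_zero]

theorem coeffA_nonneg (hc : 0 < c) (hε : 0 < ε) : 0 ≤ coeffA c ε := by
  linarith [integral_sq_eq_two_mul_coeffA hc hε, (isKernel_eta hc hε).integral_second_nonneg]

theorem coeffA_le (hc : 0 < c) (hε : 0 < ε) : coeffA c ε ≤ ε ^ 2 / (2 * c) := by
  rw [mul_comm 2 c, ← div_div]
  linarith [integral_sq_eq_two_mul_coeffA hc hε, integral_sq_mul_eta_le hc hε]

theorem abs_inv_lam_mul_le (hc : 0 < c) (hε : 0 < ε) (X : ℝ) : |(lam c ε)⁻¹ * X| ≤ |X| := by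
  have h := one_le_lam hc hε
  rw [abs_mul, abs_of_nonneg (by positivity)]
  exact mul_le_of_le_one_left (abs_nonneg _) (inv_le_one_of_one_le₀ h)

theorem convolution_mul_eq_integral (g η : ℝ → ℝ) (t : ℝ) :
    convolution g η (ContinuousLinearMap.mul ℝ ℝ) volume t = ∫ y, g (t - y) * η y := by
  rw [convolution_def, ← integral_sub_left_eq_self _ volume t]
  simp only [sub_sub_cancel, ContinuousLinearMap.mul_apply']

/-- The integral that is left of the weight `φ_{x,c,ε}(t)` after multiplication by
`λ_{c,ε} t e^{-t/2}`, with `u = t - log x`. -/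
noncomputable def truncated (c ε t u : ℝ) : ℝ :=
  ∫ y in Set.Ici u, transferKernel t⁻¹ (coeffA c ε) y * eta c ε y

theorem phi_eq (hc : 0 < c) (hε : 0 < ε) (x : ℝ) {t : ℝ} (ht : ε < t) :
    t * Real.exp (-t / 2) * phi x c ε t =
      (lam c ε)⁻¹ * truncated c ε t (t - Real.log x) := by
  rw [phi, convolution_mul_eq_integral, truncated, ← integral_indicator measurableSet_Ici,
    mul_left_comm, ← integral_const_mul]
  congr with y
  by_cases hy : |y| ≤ ε
  · have hty : t - y ≠ 0 := by linarith [(abs_le.1 hy).2]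
    by_cases h : t - y ≤ Real.log x
    · have hmem : y ∈ Set.Ici (t - Real.log x) := sub_le_comm.1 h
      rw [Set.indicator_of_mem hmem, Set.indicator_of_mem (Set.mem_Iic.2 h),
        transferKernel_inv_eq _ (hε.trans ht).ne' hty]
      ring
    · have hmem : y ∉ Set.Ici (t - Real.log x) := fun hmem => h (sub_le_comm.1 hmem)
      rw [Set.indicator_of_notMem hmem, Set.indicator_of_notMem (mt Set.mem_Iic.1 h), zero_mul,
        mul_zero]
  · simp only [Set.indicator_apply, (isKernel_eta hc hε).supp y (not_le.1 hy), mul_zero, ite_self]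

theorem truncated_of_le (hc : 0 < c) (hε : 0 < ε) (t : ℝ) {u : ℝ} (hu : ε ≤ u) :
    truncated c ε t u = 0 := by
  rw [truncated, integral_Ici_eq_integral_Ioi]
  refine setIntegral_eq_zero_of_forall_eq_zero fun y hy => ?_
  rw [(isKernel_eta hc hε).supp y (lt_abs.2 (Or.inl (hu.trans_lt hy))), mul_zero]

theorem truncated_of_le_neg (hc : 0 < c) (hε : 0 < ε) (t : ℝ) {u : ℝ} (hu : u ≤ -ε) :
    truncated c ε t u = ∫ y, transferKernel t⁻¹ (coeffA c ε) y * eta c ε y := by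
  refine setIntegral_eq_integral_of_forall_compl_eq_zero fun y hy => ?_
  rw [Set.mem_Ici, not_le] at hy
  rw [(isKernel_eta hc hε).supp y (lt_abs.2 (Or.inr (by linarith))), mul_zero]

theorem abs_inv_lam_mul_truncated_sub_one_le (hc : 0 < c) (hε : 0 < ε) (hε' : ε ≤ 1 / 10 ^ 3)
    {t u : ℝ} (ht : 0.69 ≤ t) (hu : u ≤ -ε) :
    |(lam c ε)⁻¹ * truncated c ε t u - 1| ≤ 16 * ε ^ 2 * coeffA c ε * t⁻¹ := by
  have hlam := one_le_lam hc hε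
  have hinv : t⁻¹ ≤ 1.45 := (inv_anti₀ (by norm_num) ht).trans (by norm_num)
  have hfactor :
      (lam c ε)⁻¹ * truncated c ε t u - 1 = (lam c ε)⁻¹ * (truncated c ε t u - lam c ε) := by
    field_simp
  rw [hfactor]
  refine (abs_inv_lam_mul_le hc hε _).trans ?_
  rw [truncated_of_le_neg hc hε t hu, lam_eq]
  exact (isKernel_eta hc hε).abs_integral_transferKernel_sub_le hε' (by positivity) hinv
    (integral_sq_eq_two_mul_coeffA hc hε)

-- With `w` the value of `χ*`, the integral of `quadPart` over `[u, ∞)` is `w A / 4` up to `A / 8`,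
-- and since `λ ≈ 1 + A / 4` this `w A / 4` is absorbed by `λ w`.
theorem abs_truncated_sub_le (hc : 0 < c) (hε : 0 < ε) (hε' : ε ≤ 1 / 10 ^ 3) {t : ℝ}
    (ht : 9.9 ≤ t) (u : ℝ) :
    |truncated c ε t u - lam c ε * chiStar (Set.Iic 0) u -
      (mu c ε u + (1 / t - 1 / 2) * (mu c ε u * u - nu c ε u))| ≤ 0.127 * coeffA c ε := by
  have hk := isKernel_eta hc hε
  have hsecond := integral_sq_eq_two_mul_coeffA hc hε
  have hA := coeffA_nonneg hc hε
  have hs : 0 ≤ t⁻¹ := by positivity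
  have hs' : t⁻¹ ≤ 0.11 := (inv_anti₀ (by norm_num) ht).trans (by norm_num)
  have hmain := abs_le.1 (hk.abs_integral_Ici_transferKernel_sub_le hε.le hε' hs hs' hsecond u)
  have hquad := abs_le.1 (hk.abs_integral_Ici_sub_chiStar_le
    (quadPart_nonneg hs (hs'.trans (by norm_num)) hA) (quadPart_neg t⁻¹ _)
    (hk.integrable_of_continuous (continuous_quadPart _ _)) u)
  rw [hk.integral_quadPart hsecond] at hquad
  have hlam : |lam c ε - 1 - coeffA c ε / 4| ≤ 0.0001 * coeffA c ε := by
    have h := hk.abs_integral_exp_sub_le hε'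
    rw [← lam_eq, hsecond] at h
    calc _ = |lam c ε - 1 - 2 * coeffA c ε / 8| := by ring_nf
      _ ≤ ε ^ 2 / 200 * (2 * coeffA c ε) := h
      _ ≤ (1 / 10 ^ 3) ^ 2 / 200 * (2 * coeffA c ε) := by gcongr
      _ ≤ 0.0001 * coeffA c ε := by linarith
  obtain ⟨hw₀, hw₁⟩ := chiStar_mem_Icc (Set.Iic 0) u
  have hlamw : |(lam c ε - 1 - coeffA c ε / 4) * chiStar (Set.Iic 0) u| ≤
      0.0001 * coeffA c ε := by
    rw [abs_mul, abs_of_nonneg hw₀]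
    exact (mul_le_of_le_one_right (abs_nonneg _) hw₁).trans hlam
  rw [abs_le] at hlamw
  rw [mu_mul_sub_nu hk hε, one_div t, truncated]
  rw [integral_Ici_eta hk] at hmain
  rw [abs_le]
  constructor <;> linarith

theorem abs_inv_lam_mul_truncated_sub_le (hc : 0 < c) (hε : 0 < ε) (hε' : ε ≤ 1 / 10 ^ 3)
    {t : ℝ} (ht : 9.9 ≤ t) (u : ℝ) :
    |(lam c ε)⁻¹ * truncated c ε t u - chiStar (Set.Iic 0) u - (lam c ε)⁻¹ *
      (mu c ε u + (1 / t - 1 / 2) * (mu c ε u * u - nu c ε u))| ≤ 0.127 * coeffA c ε := by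
  have hlam := one_le_lam hc hε
  refine le_trans (le_of_eq_of_le ?_ (abs_inv_lam_mul_le hc hε _))
    (abs_truncated_sub_le hc hε hε' ht u)
  congr 1
  field_simp

end Weights

end LoganPi

namespace LoganPi

theorem log_log_two_mul_sq_le {x : ℝ} (hx : 2 ≤ x) :
    Real.log (Real.log (2 * x ^ 2)) ≤ Real.log (2 * x ^ 2) / 20 + 2 := by
  have hpos : 0 < Real.log (2 * x ^ 2) := zero_lt_one.trans_le (one_le_log_two_mul_sq hx)
  have hexp : (20 : ℝ) ≤ Real.exp 3 := by
    calc (20 : ℝ) ≤ 2.718 ^ 3 := by norm_num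
      _ ≤ Real.exp 1 ^ 3 := by
        gcongr
        linarith [Real.exp_one_gt_d9]
      _ = Real.exp 3 := by
        rw [← Real.exp_nat_mul]
        norm_num
  have htangent := Real.log_le_sub_one_of_pos (div_pos hpos (Real.exp_pos 3))
  rw [Real.log_div hpos.ne' (Real.exp_pos 3).ne', Real.log_exp] at htangent
  have hdiv : Real.log (2 * x ^ 2) / Real.exp 3 ≤ Real.log (2 * x ^ 2) / 20 := by gcongr
  linarith

theorem log_mul_log_log_le {x : ℝ} (hx : Real.exp 10 < x) :
    Real.log x * Real.log (Real.log (2 * x ^ 2)) ≤ 1.2 * √x := by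
  have hx0 : 0 < x := (Real.exp_pos _).trans hx
  have hx2 : 2 ≤ x := by linarith [Real.add_one_le_exp (10 : ℝ)]
  obtain ⟨v, hv⟩ : ∃ v, Real.log x = 2 * v := ⟨Real.log x / 2, by ring⟩
  have hv5 : 5 < v := by linarith [(Real.lt_log_iff_exp_lt hx0).2 hx]
  have hsqrt : √x = Real.exp v := by
    rw [← Real.exp_log (Real.sqrt_pos.2 hx0), Real.log_sqrt hx0.le, hv,
      mul_div_cancel_left₀ _ two_ne_zero]
  have hexp : 1 + v + v ^ 2 / 2 + v ^ 3 / 6 ≤ Real.exp v := by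
    have h := Real.sum_le_exp_of_nonneg (x := v) (by linarith) 4
    norm_num [Finset.sum_range_succ, Nat.factorial] at h
    exact h
  have hloglog := log_log_two_mul_sq_le hx2
  rw [log_two_mul_sq hx0, hv] at hloglog ⊢
  have hcubic : 5 * v ^ 2 ≤ v ^ 3 := by nlinarith [sq_nonneg v]
  calc 2 * v * Real.log (Real.log 2 + 2 * (2 * v)) ≤ 2 * v * (0.2 * v + 2.04) := by
        gcongr
        linarith [Real.log_two_lt_d9]
    _ ≤ 1.2 * (1 + v + v ^ 2 / 2 + v ^ 3 / 6) := by nlinarith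
    _ ≤ 1.2 * √x := by
        rw [hsqrt]
        gcongr

section ErrorBound

variable {x c ε A : ℝ}

theorem sqrt_mul_log_log_le (hx : Real.exp 10 < x) :
    √x * Real.log (Real.log (2 * x ^ 2)) ≤ 1.2 * x / Real.log x := by
  have hlog : 0 < Real.log x := Real.log_pos ((Real.one_lt_exp_iff.2 (by norm_num)).trans hx)
  rw [le_div_iff₀ hlog]
  calc √x * Real.log (Real.log (2 * x ^ 2)) * Real.log x
      = √x * (Real.log x * Real.log (Real.log (2 * x ^ 2))) := by ring
    _ ≤ √x * (1.2 * √x) := mul_le_mul_of_nonneg_left (log_mul_log_log_le hx) (Real.sqrt_nonneg x)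
    _ = 1.2 * x := by rw [mul_left_comm, Real.mul_self_sqrt ((Real.exp_pos _).trans hx).le]

theorem near_error_le (hx : Real.exp 10 < x) (hc : 0 < c) (hε : 0 < ε) (hε' : ε ≤ 1)
    (hεx : 1 < ε * x) (hA : A ≤ ε ^ 2 / (2 * c)) :
    0.127 * A * (7.2 * (ε * x) / Real.log (ε * x) +
      (1 + 1.01 * ε * √x) * Real.log (Real.log (2 * x ^ 2))) ≤
    0.54 * (ε ^ 3 * x / (c * Real.log (ε * x))) +
      0.13 * ε ^ 2 * Real.log (Real.log (2 * x ^ 2)) / c := by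
  have hx0 : 0 < x := (Real.exp_pos _).trans hx
  have hlog : 0 < Real.log (ε * x) := Real.log_pos hεx
  have hlogle : Real.log (ε * x) ≤ Real.log x :=
    Real.log_le_log (by positivity) (mul_le_of_le_one_left hx0.le hε')
  have hloglog : 0 ≤ Real.log (Real.log (2 * x ^ 2)) :=
    Real.log_nonneg (one_le_log_two_mul_sq (by linarith [Real.add_one_le_exp (10 : ℝ)]))
  have hsqrt : √x * Real.log (Real.log (2 * x ^ 2)) ≤ 1.2 * x / Real.log (ε * x) :=
    (sqrt_mul_log_log_le hx).trans (by gcongr)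
  calc _ = 0.127 * A * (7.2 * (ε * x) / Real.log (ε * x) + Real.log (Real.log (2 * x ^ 2)) +
          1.01 * ε * (√x * Real.log (Real.log (2 * x ^ 2)))) := by ring
    _ ≤ 0.127 * (ε ^ 2 / (2 * c)) * (7.2 * (ε * x) / Real.log (ε * x) +
          Real.log (Real.log (2 * x ^ 2)) + 1.01 * ε * (1.2 * x / Real.log (ε * x))) := by
        gcongr
    _ = 0.534162 * (ε ^ 3 * x / (c * Real.log (ε * x))) +
          0.0635 * ε ^ 2 * Real.log (Real.log (2 * x ^ 2)) / c := by
        field_simp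
        ring
    _ ≤ _ := by
        gcongr <;> norm_num

theorem far_error_le (hx : 0 < x) (hc : 0 < c) (hε : 0 < ε) (hε' : ε ≤ 1 / 10 ^ 3)
    (hεx : 1 < ε * x) (hA : A ≤ ε ^ 2 / (2 * c)) :
    16 * ε ^ 2 * A * (3 * x / Real.log x) ≤
      0.03 * (ε ^ 3 * x / (c * Real.log (ε * x))) := by
  have hlog : 0 < Real.log (ε * x) := Real.log_pos hεx
  have hlogle : Real.log (ε * x) ≤ Real.log x :=
    Real.log_le_log (by positivity) (mul_le_of_le_one_left hx.le (hε'.trans (by norm_num)))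
  have hlogx : 0 < Real.log x := hlog.trans_le hlogle
  calc 16 * ε ^ 2 * A * (3 * x / Real.log x)
      ≤ 16 * ε ^ 2 * (ε ^ 2 / (2 * c)) * (3 * x / Real.log (ε * x)) := by gcongr
    _ = 24 * ε * (ε ^ 3 * x / (c * Real.log (ε * x))) := by
        field_simp
        ring
    _ ≤ 0.03 * (ε ^ 3 * x / (c * Real.log (ε * x))) := by
        gcongr
        linarith

end ErrorBound

theorem piModTerm_eq {c ε : ℝ} (hc : 0 < c) (hε : 0 < ε) (hε' : ε ≤ 1 / 10 ^ 3) (x : ℝ) (q : PP) :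
    piModTerm x c ε q = 1 / (q.m : ℝ) * ((lam c ε)⁻¹ *
      truncated c ε (Real.log q.val) (Real.log q.val - Real.log x)) := by
  have hp : 0 < q.p := two_pos.trans_le q.two_le_p
  have hm : (0 : ℝ) < q.m := Nat.cast_pos.2 q.m_pos
  have hlt : ε < Real.log q.val := by linarith [q.log_two_le_log_val, Real.log_two_gt_d9]
  have hexponent : -(Real.log q.val) / 2 = -(Real.log q.p * ((q.m : ℝ) / 2)) := by
    rw [q.log_val]
    ring
  rw [← phi_eq hc hε x hlt, hexponent, Real.exp_neg, ← Real.rpow_def_of_pos hp, piModTerm,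
    q.log_val]
  field_simp

theorem chiStar_Iic_eq_ite (x t : ℝ) [Decidable (t < x)] [Decidable (t ≤ x)] :
    chiStar (Set.Iic x) t = 1 / 2 * (if t < x then 1 else 0) + 1 / 2 * if t ≤ x then 1 else 0 := by
  rcases lt_trichotomy t x with h | rfl | h
  · norm_num [chiStar_Iic_of_lt h, h, h.le]
  · norm_num [chiStar_Iic_self]
  · norm_num [chiStar_Iic_of_gt h, h.not_gt, h.not_ge]

theorem chiStar_Iic_zero_log_sub {x t : ℝ} (hx : 0 < x) (ht : 0 < t) :
    chiStar (Set.Iic 0) (Real.log t - Real.log x) = chiStar (Set.Iic x) t := by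
  classical
  simp only [chiStar_Iic_eq_ite, sub_neg, sub_nonpos, Real.log_lt_log_iff ht hx,
    Real.log_le_log_iff ht hx]

open Classical in
/-- The amount by which the weight of the prime power `q` in the modified prime-counting function
exceeds the sum of its weights in `piStar x` and in `shortSum x c ε`, all three multiplied by
`q.m`. -/
noncomputable def discrepancy (x c ε : ℝ) (q : PP) : ℝ :=
  (lam c ε)⁻¹ * truncated c ε (Real.log q.val) (Real.log q.val - Real.log x) -
    chiStar (Set.Iic x) q.val -
    if Real.exp (-ε) * x < q.val ∧ q.val < Real.exp ε * x then bigM x c ε q.val else 0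

section Discrepancy

variable {x c ε : ℝ} {q : PP}

theorem truncated_eq_zero_of_exp_mul_le (hx : 0 < x) (hc : 0 < c) (hε : 0 < ε)
    (hq : Real.exp ε * x ≤ q.val) (t : ℝ) :
    truncated c ε t (Real.log q.val - Real.log x) = 0 := by
  have hlog := Real.log_le_log (by positivity) hq
  rw [log_exp_mul hx] at hlog
  exact truncated_of_le hc hε _ (by linarith)

theorem discrepancy_of_exp_mul_le (hx : 0 < x) (hc : 0 < c) (hε : 0 < ε)
    (hq : Real.exp ε * x ≤ q.val) : discrepancy x c ε q = 0 := by
  have hlt : x < q.val := (lt_mul_of_one_lt_left hx (Real.one_lt_exp_iff.2 hε)).trans_le hq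
  rw [discrepancy, truncated_eq_zero_of_exp_mul_le hx hc hε hq, chiStar_Iic_of_gt hlt,
    if_neg fun h => hq.not_gt h.2, mul_zero, sub_zero, sub_zero]

theorem abs_discrepancy_le_of_near (hx : Real.exp 10 < x) (hc : 0 < c) (hε : 0 < ε)
    (hε' : ε ≤ 1 / 10 ^ 3) (hq : Real.exp (-ε) * x < q.val ∧ q.val < Real.exp ε * x) :
    |discrepancy x c ε q| ≤ 0.127 * coeffA c ε := by
  have hx0 : 0 < x := (Real.exp_pos _).trans hx
  have hlogx := (Real.lt_log_iff_exp_lt hx0).2 hx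
  have hlog := Real.log_le_log (by positivity) hq.1.le
  rw [log_exp_mul hx0] at hlog
  rw [discrepancy, if_pos hq, bigM, Real.log_div q.val_pos.ne' hx0.ne',
    ← chiStar_Iic_zero_log_sub hx0 q.val_pos]
  exact abs_inv_lam_mul_truncated_sub_le hc hε hε' (by linarith) _

theorem abs_discrepancy_le_of_le_exp_neg_mul (hx : 0 < x) (hc : 0 < c) (hε : 0 < ε)
    (hε' : ε ≤ 1 / 10 ^ 3) (hq : q.val ≤ Real.exp (-ε) * x) :
    |discrepancy x c ε q| ≤ 16 * ε ^ 2 * coeffA c ε * (Real.log q.val)⁻¹ := by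
  have hlt : q.val < x :=
    hq.trans_lt (mul_lt_of_lt_one_left hx (Real.exp_lt_one_iff.2 (neg_lt_zero.2 hε)))
  have hlog := Real.log_le_log q.val_pos hq
  rw [log_exp_mul hx] at hlog
  rw [discrepancy, chiStar_Iic_of_lt hlt, if_neg fun h => hq.not_gt h.1, sub_zero]
  exact abs_inv_lam_mul_truncated_sub_one_le hc hε hε'
    (by linarith [q.log_two_le_log_val, Real.log_two_gt_d9]) (by linarith)

open Classical in
theorem abs_inv_m_mul_discrepancy_le (hx : Real.exp 10 < x) (hc : 0 < c) (hε : 0 < ε)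
    (hε' : ε ≤ 1 / 10 ^ 3) :
    |1 / (q.m : ℝ) * discrepancy x c ε q| ≤
      (if Real.exp (-ε) * x < q.val ∧ q.val < Real.exp ε * x then
        0.127 * coeffA c ε * (1 / (q.m : ℝ)) else 0) +
      if q.val ≤ Real.exp (-ε) * x then
        16 * ε ^ 2 * coeffA c ε * (Real.log q.val)⁻¹ else 0 := by
  have hx0 : 0 < x := (Real.exp_pos _).trans hx
  have hm : 1 / (q.m : ℝ) ≤ 1 := div_le_one_of_le₀ (Nat.one_le_cast.2 q.m_pos) (Nat.cast_nonneg _)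
  rw [abs_mul, abs_of_nonneg (by positivity)]
  by_cases hfar : q.val ≤ Real.exp (-ε) * x
  · rw [if_neg fun h => hfar.not_gt h.1, if_pos hfar, zero_add]
    exact (mul_le_of_le_one_left (abs_nonneg _) hm).trans
      (abs_discrepancy_le_of_le_exp_neg_mul hx0 hc hε hε' hfar)
  · rw [if_neg hfar, add_zero]
    split_ifs with hnear
    · rw [mul_comm]
      gcongr
      exact abs_discrepancy_le_of_near hx hc hε hε' hnear
    · rw [discrepancy_of_exp_mul_le hx0 hc hε (not_lt.1 fun h => hnear ⟨not_le.1 hfar, h⟩),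
        abs_zero, mul_zero]

end Discrepancy

section Sums

variable {x c ε : ℝ} {F : Finset PP}

theorem piModTerm_eq_zero (hx : 0 < x) (hc : 0 < c) (hε : 0 < ε) (hε' : ε ≤ 1 / 10 ^ 3) {q : PP}
    (hq : Real.exp ε * x ≤ q.val) : piModTerm x c ε q = 0 := by
  rw [piModTerm_eq hc hε hε', truncated_eq_zero_of_exp_mul_le hx hc hε hq, mul_zero, mul_zero]

theorem piStar_eq_sum (hF : ∀ q ∉ F, x < q.val) :
    piStar x = ∑ q ∈ F, 1 / (q.m : ℝ) * chiStar (Set.Iic x) q.val := by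
  rw [piStar, tsum_eq_sum fun q hq => if_neg (hF q hq).not_gt,
    tsum_eq_sum fun q hq => if_neg (hF q hq).not_ge, Finset.mul_sum, Finset.mul_sum,
    ← Finset.sum_add_distrib]
  refine Finset.sum_congr rfl fun q _ => ?_
  rw [chiStar_Iic_eq_ite, ← mul_boole, ← mul_boole (q.val ≤ x)]
  ring

theorem piMod_sub_piStar_sub_shortSum_eq_sum (hx : 0 < x) (hc : 0 < c) (hε : 0 < ε)
    (hε' : ε ≤ 1 / 10 ^ 3) (hF : ∀ q ∉ F, Real.exp ε * x ≤ q.val) :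
    piMod c ε x - piStar x - shortSum x c ε = ∑ q ∈ F, 1 / (q.m : ℝ) * discrepancy x c ε q := by
  have hmod : piMod c ε x = ∑ q ∈ F, piModTerm x c ε q :=
    tsum_eq_sum fun q hq => piModTerm_eq_zero hx hc hε hε' (hF q hq)
  have hstar := piStar_eq_sum (x := x) fun q hq =>
    (lt_mul_of_one_lt_left hx (Real.one_lt_exp_iff.2 hε)).trans_le (hF q hq)
  rw [hmod, hstar, shortSum, tsum_eq_sum fun q hq => if_neg fun h => (hF q hq).not_gt h.2,
    ← Finset.sum_sub_distrib, ← Finset.sum_sub_distrib]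
  refine Finset.sum_congr rfl fun q _ => ?_
  rw [piModTerm_eq hc hε hε', discrepancy, mul_sub, mul_sub, mul_ite, mul_zero]

theorem abs_sum_discrepancy_le (hx : Real.exp 10 < x) (hc : 0 < c) (hε : 0 < ε)
    (hε' : ε ≤ 1 / 10 ^ 3) (hεx : 1 < ε * x) (F : Finset PP) :
    |∑ q ∈ F, 1 / (q.m : ℝ) * discrepancy x c ε q| ≤
      0.127 * coeffA c ε * (7.2 * (ε * x) / Real.log (ε * x) +
        (1 + 1.01 * ε * √x) * Real.log (Real.log (2 * x ^ 2))) +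
      16 * ε ^ 2 * coeffA c ε * (3 * x / Real.log x) := by
  classical
  have hx16 : 16 ≤ x := by linarith [Real.quadratic_le_exp_of_nonneg (x := 10) (by norm_num)]
  have hA := coeffA_nonneg hc hε
  refine (Finset.abs_sum_le_sum_abs _ _).trans ((Finset.sum_le_sum fun q _ =>
    abs_inv_m_mul_discrepancy_le hx hc hε hε').trans ?_)
  rw [Finset.sum_add_distrib, ← Finset.sum_filter, ← Finset.sum_filter, ← Finset.mul_sum,
    ← Finset.mul_sum]
  gcongr
  · exact sum_inv_m_near_le (by linarith) hε' hε hεx fun q hq => (Finset.mem_filter.1 hq).2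
  · refine sum_inv_log_val_le hx16 _ fun q hq => (Finset.mem_filter.1 hq).2.trans ?_
    exact mul_le_of_le_one_left (by linarith) (Real.exp_le_one_iff.2 (by linarith))

end Sums

end LoganPi

theorem theorem1_general (x c ε : ℝ) (hx : Real.exp 10 < x) (hc : 0 < c) (hε : x⁻¹ < ε)
    (hε' : ε ≤ 1 / 10 ^ 3) :
    Summable (LoganPi.piModTerm x c ε) ∧
      ∃ R : ℝ,
        LoganPi.piMod c ε x = LoganPi.piStar x + LoganPi.shortSum x c ε + R ∧
        |R| ≤ 0.57 * ε ^ 3 * x / (c * Real.log (ε * x)) +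
          0.13 * ε ^ 2 * Real.log (Real.log (2 * x ^ 2)) / c := by
  have hx0 : 0 < x := (Real.exp_pos _).trans hx
  have hε0 : 0 < ε := (inv_pos.2 hx0).trans hε
  have hεx : 1 < ε * x := (inv_lt_iff_one_lt_mul₀ hx0).1 hε
  set F := (LoganPi.finite_setOf_val_le (Real.exp ε * x)).toFinset with hFdef
  have hF : ∀ q ∉ F, Real.exp ε * x ≤ q.val := fun q hq => by
    rw [hFdef, Set.Finite.mem_toFinset, Set.mem_ofPred_eq, not_le] at hq
    exact hq.le
  refine ⟨summable_of_ne_finset_zero fun q hq =>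
    LoganPi.piModTerm_eq_zero hx0 hc hε0 hε' (hF q hq), _, (add_sub_cancel _ _).symm, ?_⟩
  have hA := LoganPi.coeffA_le hc hε0
  have hnear := LoganPi.near_error_le hx hc hε0 (hε'.trans (by norm_num)) hεx hA
  have hfar := LoganPi.far_error_le hx0 hc hε0 hε' hεx hA
  rw [← sub_sub, LoganPi.piMod_sub_piStar_sub_shortSum_eq_sum hx0 hc hε0 hε' hF]
  calc _ ≤ _ := LoganPi.abs_sum_discrepancy_le hx hc hε0 hε' hεx F
    _ ≤ 0.57 * (ε ^ 3 * x / (c * Real.log (ε * x))) +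
        0.13 * ε ^ 2 * Real.log (Real.log (2 * x ^ 2)) / c := by linarith
    _ = _ := by ring

theorem theorem1 (x c ε : ℝ) (hx : Real.exp 10 < x) (hc : 1 ≤ c) (hε : x⁻¹ < ε)
    (hε' : ε ≤ 1 / 10 ^ 3) :
    Summable (LoganPi.piModTerm x c ε) ∧
      ∃ R : ℝ,
        LoganPi.piMod c ε x = LoganPi.piStar x + LoganPi.shortSum x c ε + R ∧
        |R| ≤ 0.57 * ε ^ 3 * x / (c * Real.log (ε * x)) + 39 * ε ^ 4 * x / c ^ 3 +
          0.13 * ε ^ 2 * Real.log (Real.log (2 * x ^ 2)) / c := by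
  obtain ⟨hsum, R, hR, hle⟩ := theorem1_general x c ε hx (by linarith) hε hε'
  have hx0 : 0 < x := (Real.exp_pos _).trans hx
  exact ⟨hsum, R, hR, hle.trans (by gcongr; exact le_add_of_nonneg_right (by positivity))⟩
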